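/- **Setting.** For a finite alphabet $\Sigma$ let $\mathcal T_{\Sigma^*}$ be the structure with domain $\Sigma^*$ and the successor functions $w\mapsto wa$ ($a\in\Sigma$). A parity game graph $(V_1,V_2,E,c)$ has disjoint vertex sets $V_1$ (Player I) and $V_2$ (Player II), edges $E$ between vertices such that every vertex has out-degree $\ge 1$, and a coloring $c\colon V_1\cup V_2\to\{0,\dots,d\}$. A play from $u_0$ is an infinite path starting in $u_0$; Player II wins it iff the maximal color occurring infinitely often is even, otherwise Player I wins it. A memoryless strategy $\sigma$ from $u_0$ for a player assigns to each vertex $x$ of this player that is reachable from $u_0$ a vertex $\sigma(x)$ with $(x,\sigma(x))\in E$; it is winning if every play from $u_0$ compatible with $\sigma$ is won by this player. An MSO-formula $\chi(x,y)$ over $\mathcal T_{\Sigma^*}$ (where the vertices are words over $\Sigma$) defines $\sigma$ if for every such $x$ and all $y\in\Sigma^*$: $\mathcal T_{\Sigma^*}\models\chi[x,y]$ iff $y=\sigma(x)$. Let $\mathbb B=\mathbb A\cup Q_I\cup Q_{II}$ be a finite alphabet (disjoint union), and let $G=(V_1,V_2,E,c)$ be a normal prefix-recognizable parity game graph over $\mathbb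 B$: $V_1=\mathbb A^*Q_I$, $V_2=\mathbb A^*Q_{II}$, the color of $wq$ depends only on $q$ (write $c(q)$), and $V_1$, $V_2$, $E$ and the sets $c^{-1}(i)$ are MSO-definable in $\mathcal T_{\mathbb B^*}$. Let $U_i,V_i,W_i\subseteq\mathbb B^*$ ($i=1,\dots,k$) be regular languages such that for all vertices $x,y$ of $G$ $$(x,y)\in E\iff \exists i\ \exists u\in U_i\ \exists v\in V_i\ \exists w\in W_i\ (wu=x\wedge wv=y),$$ where for no $i$ the empty word belongs to both $U_i$ and $V_i$. Let $\mathcal U_i',\mathcal V_i,\mathcal W_i'$ be deterministic finite automata, with pairwise disjoint state sets, recognizing the reversal of $U_i$, the language $V_i$, and the reversal of $W_i$, respectively, where no transition of $\mathcal W_i'$ leads to its initial state. Let $S$ be the union of all their state sets. **The pushdown game graph $H$.** Its control states are $P_I=Q_I\cup\{s_I\mid s\in S\}\cup\{s^{II}_{\rm win}\}$ for Player I and $P_{II}=Q_{II}\cup\{s_{II}\mid s\in S\}\cup\{s^{I}_{\rm win}\}$ for Player II. Its vertices are the words in $\mathbb A^*P_I$ (Player I) and $\mathbb A^*P_{II}$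 (Player II) over $\mathbb C=\mathbb A\cup P_I\cup P_{II}$. The color of $wq$ is $c(q)+2$ for $q\in Q_I\cup Q_{II}$, it is $0$ for the other control states in $P_I$, and $1$ for the other control states in $P_{II}$. A pushdown rule $ap\to vq$ ($a\in\mathbb A$, $v\in\mathbb A^*$) yields the edges $(wap,wvq)$ with $w\in\mathbb A^*$; a rule $\bot p\to\bot vq$ yields the edge $(p,vq)$; $p\to vq$ stands for all rules $ap\to avq$ with $a\in\mathbb A\cup\{\bot\}$. With $J$ ranging over the players, $\bar J$ denoting the opponent of $J$, and $1\le i\le k$, the rules are: 1. $q\to s_J$ for $q\in Q_J$, where $s$ is the state of $\mathcal U_i'$ reached from its initial state by reading $q$; 2. $as_J\to s'_J$ for each transition of $\mathcal U_i'$ from $s$ via $a\in\mathbb A$ to $s'$, and $\bot s_J\to\bot s_J$ for each state $s$ of $\mathcal U_i'$; 3. $s_J\to t_{\bar J}$ for each accepting state $s$ of $\mathcal U_i'$, where $t$ is the initial state of $\mathcal W_i'$; 4. $as_{\bar J}\to s'_{\bar J}$ for each transition of $\mathcal W_i'$ from $s$ via $a\in\mathbb A$ to $s'$; and, for each state $s$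 of $\mathcal W_i'$, $\bot s_{\bar J}\to\bot s^{J}_{\rm win}$ if $s$ is accepting and $\bot s_{\bar J}\to\bot s^{\bar J}_{\rm win}$ otherwise; 5. $t_{\bar J}\to r_J$, where $t$ and $r$ are the initial states of $\mathcal W_i'$ and $\mathcal V_i$; 6. $r_J\to ar'_J$ for each transition of $\mathcal V_i$ from $r$ via $a\in\mathbb A$ to $r'$; 7. $r_J\to q$ for each state $r$ of $\mathcal V_i$ and each $q\in Q_I\cup Q_{II}$ such that $\mathcal V_i$ leads from $r$ via $q$ to an accepting state; 8. $s^{J}_{\rm win}\to s^{J}_{\rm win}$; and a self-loop at each vertex to which no other rule applies. **Proposition.** Let $u_0$ be a vertex of $G$, and let $\tau$ be a winning strategy from $u_0$ in $H$ for one of the players that is defined by an MSO-formula $\varphi_\tau(x,y)$ over $\mathcal T_{\mathbb C^*}$. Then there is a winning strategy $\sigma$ from $u_0$ in $G$ for the same player that is defined by an MSO-formula $\chi_\sigma(x,y)$ over $\mathcal T_{\mathbb B^*}$. -/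

import Mathlib

namespace MSOGame

/-! ### Monadic second-order logic over the tree structures `T_{Σ*}` -/

/-- MSO-formulas in the signature of the tree of all finite words over `Sg` (with its successor
functions `w ↦ w a`), with free first-order variables indexed by `Fin n` and free set variables
indexed by `Fin m`.  A quantifier binds the variable with index `0`. -/
inductive MSO (Sg : Type) : ℕ → ℕ → Type
  /-- `x = y` -/
  | eq {n m : ℕ} (x y : Fin n) : MSO Sg n m
  /-- `succ_a(x) = y` -/
  | succ {n m : ℕ} (a : Sg) (x y : Fin n) : MSO Sg n m
  /-- `X(x)` -/
  | mem {n m : ℕ} (x : Fin n) (X : Fin m) : MSO Sg n m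
  | neg {n m : ℕ} (φ : MSO Sg n m) : MSO Sg n m
  | and {n m : ℕ} (φ ψ : MSO Sg n m) : MSO Sg n m
  /-- first-order quantification over nodes -/
  | exNode {n m : ℕ} (φ : MSO Sg (n + 1) m) : MSO Sg n m
  /-- second-order quantification over sets of nodes -/
  | exSet {n m : ℕ} (φ : MSO Sg n (m + 1)) : MSO Sg n m

/-- Satisfaction in the tree structure over the alphabet `Sg`: the nodes are the words over `Sg`,
and `succ_a` appends the letter `a` at the right end. -/
def MSO.Sat {Sg : Type} : {n m : ℕ} → MSO Sg n m → (Fin n → List Sg) →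
    (Fin m → Set (List Sg)) → Prop
  | _, _, .eq x y, ρ, _ => ρ x = ρ y
  | _, _, .succ a x y, ρ, _ => ρ x ++ [a] = ρ y
  | _, _, .mem x X, ρ, S => ρ x ∈ S X
  | _, _, .neg φ, ρ, S => ¬ φ.Sat ρ S
  | _, _, .and φ ψ, ρ, S => φ.Sat ρ S ∧ ψ.Sat ρ S
  | _, _, .exNode φ, ρ, S => ∃ w : List Sg, φ.Sat (Fin.cons w ρ : Fin _ → List Sg) S
  | _, _, .exSet φ, ρ, S =>
      ∃ X : Set (List Sg), φ.Sat ρ (Fin.cons X S : Fin _ → Set (List Sg))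

/-- `T ⊨ φ[x]` for a formula with one free first-order variable. -/
def MSO.Holds₁ {Sg : Type} (φ : MSO Sg 1 0) (x : List Sg) : Prop := φ.Sat ![x] ![]

/-- `T ⊨ φ[x, y]` for a formula with two free first-order variables. -/
def MSO.Holds₂ {Sg : Type} (φ : MSO Sg 2 0) (x y : List Sg) : Prop := φ.Sat ![x, y] ![]

/-! ### Parity games on graphs -/

/-- The two players: `one` is Player I, `two` is Player II. -/
inductive Player
  | one
  | two

/-- The opponent. -/
def Player.other : Player → Player
  | .one => .two
  | .two => .one

/-- Parity game graphs `(V₁, V₂, E, c)` with vertices in `α`.  (Only the values of `color` on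
vertices matter.) -/
structure ParityGameGraph (α : Type) where
  V₁ : Set α
  V₂ : Set α
  disjoint : Disjoint V₁ V₂
  E : α → α → Prop
  edge_mem : ∀ u v, E u v → u ∈ V₁ ∪ V₂ ∧ v ∈ V₁ ∪ V₂
  /-- no deadlocks -/
  exists_edge : ∀ u ∈ V₁ ∪ V₂, ∃ v, E u v
  color : α → ℕ
  color_bounded : ∃ d, ∀ u ∈ V₁ ∪ V₂, color u ≤ d

namespace ParityGameGraph

variable {α : Type} (G : ParityGameGraph α)

/-- The set of all vertices. -/
def V : Set α := G.V₁ ∪ G.V₂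

/-- The vertices at which the given player has to move. -/
def ownedBy : Player → Set α
  | .one => G.V₁
  | .two => G.V₂

/-- `π` is a play from `u₀`. -/
def IsPlay (u₀ : α) (π : ℕ → α) : Prop := π 0 = u₀ ∧ ∀ n, G.E (π n) (π (n + 1))

/-- Parity condition: the maximal color that occurs infinitely often along `π` is even. -/
def ParityCondition (π : ℕ → α) : Prop :=
  ∃ m, IsGreatest {c | ∃ᶠ n in Filter.atTop, G.color (π n) = c} m ∧ Even m

/-- Player II wins the plays that satisfy the parity condition, Player I wins the others. -/
def WonBy : Player → (ℕ → α) → Prop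
  | .one, π => ¬ G.ParityCondition π
  | .two, π => G.ParityCondition π

/-- `u` is the last vertex of some finite play prefix that starts in `u₀`. -/
def ReachableFrom (u₀ u : α) : Prop := Relation.ReflTransGen G.E u₀ u

/-- `σ` is a memoryless strategy from `u₀` for player `P`: for each finite play prefix that
starts in `u₀` and ends in a vertex `u` of `P`, it selects a successor of `u` that depends only
on `u`. -/
def IsMemorylessStrategy (P : Player) (u₀ : α) (σ : α → α) : Prop :=
  ∀ u ∈ G.ownedBy P, G.ReachableFrom u₀ u → G.E u (σ u)

/-- `σ` is a memoryless winning strategy from `u₀` for player `P`: each play from `u₀` that is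
compatible with `σ` is won by `P`. -/
def IsWinningStrategy (P : Player) (u₀ : α) (σ : α → α) : Prop :=
  G.IsMemorylessStrategy P u₀ σ ∧
    ∀ π : ℕ → α, G.IsPlay u₀ π → (∀ n, π n ∈ G.ownedBy P → π (n + 1) = σ (π n)) → G.WonBy P π

end ParityGameGraph

/-- The formula `χ(x, y)` defines the memoryless strategy `σ` from `u₀` of player `P`: for each
vertex `x` at which `σ` has to specify a move, `y = σ x` is the unique `y` with `T ⊨ χ[x, y]`. -/
def MSO.DefinesStrategy {Sg : Type} (χ : MSO Sg 2 0) (G : ParityGameGraph (List Sg))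
    (P : Player) (u₀ : List Sg) (σ : List Sg → List Sg) : Prop :=
  ∀ x ∈ G.ownedBy P, G.ReachableFrom u₀ x → ∀ y, χ.Holds₂ x y ↔ y = σ x

/-- A parity game graph whose vertices are words over `Sg` is prefix-recognizable if vertex sets,
edge relation and coloring are defined by MSO-formulas in the tree structure over `Sg`. -/
def ParityGameGraph.IsPrefixRecognizable {Sg : Type} (G : ParityGameGraph (List Sg)) : Prop :=
  ∃ (d : ℕ) (φ₁ φ₂ : MSO Sg 1 0) (ψ : MSO Sg 2 0) (δ : Fin (d + 1) → MSO Sg 1 0),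
    (∀ u, u ∈ G.V₁ ↔ φ₁.Holds₁ u) ∧ (∀ u, u ∈ G.V₂ ↔ φ₂.Holds₁ u) ∧
    (∀ u v, G.E u v ↔ ψ.Holds₂ u v) ∧
    (∀ u ∈ G.V, G.color u ≤ d) ∧
    (∀ (i : Fin (d + 1)) (u), (u ∈ G.V ∧ G.color u = i) ↔ (δ i).Holds₁ u)

/-- The word `w p` over the alphabet `A ∪ P`, with `w` a word over `A` and `p` in `P`. -/
def vertex {A P : Type} (w : List A) (p : P) : List (A ⊕ P) := w.map Sum.inl ++ [Sum.inr p]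

theorem vertex_inj {A P : Type} {w w' : List A} {p p' : P} :
    vertex w p = vertex w' p' ↔ w = w' ∧ p = p' := by
  unfold vertex
  constructor
  · intro h
    obtain ⟨h₁, h₂⟩ := List.append_inj' h rfl
    exact ⟨List.map_injective_iff.2 Sum.inl_injective h₁, by simpa using h₂⟩
  · rintro ⟨rfl, rfl⟩
    rfl

/-- A parity game graph over the alphabet `B = A ∪ Q_I ∪ Q_II` is normal if `V₁ = A* Q_I`,
`V₂ = A* Q_II`, and the color of a vertex `w q` depends only on `q`. -/
structure ParityGameGraph.IsNormal {A QI QII : Type}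
    (G : ParityGameGraph (List (A ⊕ (QI ⊕ QII)))) : Prop where
  V₁_eq : G.V₁ = {x | ∃ (w : List A) (q : QI), x = vertex w (Sum.inl q)}
  V₂_eq : G.V₂ = {x | ∃ (w : List A) (q : QII), x = vertex w (Sum.inr q)}
  color_eq : ∀ (w w' : List A) (q : QI ⊕ QII), G.color (vertex w q) = G.color (vertex w' q)

/-! ### Pushdown parity games -/

/-- Pushdown rules: `⟨some a, p, v, q⟩` stands for `a p → v q` (with `a` in `A`), and
`⟨none, p, v, q⟩` stands for `⊥ p → ⊥ v q`. -/
structure PushdownRule (A P : Type) where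
  top : Option A
  src : P
  push : List A
  tgt : P

/-- Pushdown parity game systems over the alphabet `A` with state sets `PI` and `PII`.  The field
`exists_rule` says that there are no deadlocks in the induced graph. -/
structure PushdownSystem (A PI PII : Type) where
  rules : Set (PushdownRule A (PI ⊕ PII))
  rules_finite : rules.Finite
  exists_rule : ∀ (top : Option A) (p : PI ⊕ PII), ∃ r ∈ rules, r.top = top ∧ r.src = p
  color : PI ⊕ PII → ℕ

/-- The edges of the graph induced by a set of pushdown rules. -/
inductive PushdownEdge {A P : Type} (rules : Set (PushdownRule A P)) :
    List (A ⊕ P) → List (A ⊕ P) → Prop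
  | letter (w : List A) (a : A) (p : P) (v : List A) (q : P) (h : ⟨some a, p, v, q⟩ ∈ rules) :
      PushdownEdge rules (vertex (w ++ [a]) p) (vertex (w ++ v) q)
  | bottom (p : P) (v : List A) (q : P) (h : ⟨none, p, v, q⟩ ∈ rules) :
      PushdownEdge rules (vertex [] p) (vertex v q)

/-- The color of a word `w p` is the color of its control state `p`. -/
def wordColor {A P : Type} (c : P → ℕ) (x : List (A ⊕ P)) : ℕ :=
  match x.getLast? with
  | some (Sum.inr p) => c p
  | _ => 0

theorem wordColor_vertex {A P : Type} (c : P → ℕ) (w : List A) (p : P) :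
    wordColor c (vertex w p) = c p := by
  simp [wordColor, vertex]

/-- The parity game graph induced by a pushdown parity game system. -/
def PushdownSystem.graph {A PI PII : Type} [Finite PI] [Finite PII]
    (S : PushdownSystem A PI PII) : ParityGameGraph (List (A ⊕ (PI ⊕ PII))) where
  V₁ := {x | ∃ (w : List A) (p : PI), x = vertex w (Sum.inl p)}
  V₂ := {x | ∃ (w : List A) (p : PII), x = vertex w (Sum.inr p)}
  disjoint := by
    rw [Set.disjoint_left]
    rintro x ⟨w, p, rfl⟩ ⟨w', p', h⟩
    simpa using (vertex_inj.1 h).2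
  E := PushdownEdge S.rules
  edge_mem := by
    have key : ∀ (w : List A) (p : PI ⊕ PII),
        vertex w p ∈ {x | ∃ (w : List A) (p : PI), x = vertex w (Sum.inl p : PI ⊕ PII)} ∪
          {x | ∃ (w : List A) (p : PII), x = vertex w (Sum.inr p : PI ⊕ PII)} := by
      rintro w (p | p)
      · exact Or.inl ⟨w, p, rfl⟩
      · exact Or.inr ⟨w, p, rfl⟩
    rintro u v (⟨w, a, p, v, q, h⟩ | ⟨p, v, q, h⟩) <;> exact ⟨key _ _, key _ _⟩
  exists_edge := by
    have key : ∀ (w : List A) (p : PI ⊕ PII), ∃ y, PushdownEdge S.rules (vertex w p) y := by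
      intro w p
      rcases List.eq_nil_or_concat w with rfl | ⟨w, a, rfl⟩
      · obtain ⟨⟨t, p', v, q⟩, hr, rfl, rfl⟩ := S.exists_rule none p
        exact ⟨_, .bottom _ v q hr⟩
      · obtain ⟨⟨t, p', v, q⟩, hr, rfl, rfl⟩ := S.exists_rule (some a) p
        rw [List.concat_eq_append]
        exact ⟨_, .letter w a _ v q hr⟩
    rintro x (⟨w, p, rfl⟩ | ⟨w, p, rfl⟩) <;> exact key _ _
  color := wordColor S.color
  color_bounded := by
    obtain ⟨d, hd⟩ := (Set.finite_range S.color).bddAbove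
    refine ⟨d, ?_⟩
    rintro x (⟨w, p, rfl⟩ | ⟨w, p, rfl⟩) <;>
      exact (wordColor_vertex S.color w _).trans_le (hd ⟨_, rfl⟩)

/-! ### Representation of the edges by rules `(U, V, W)` -/

/-- A finite family of triples `(U, V, W)` of regular languages over `B`, together with
deterministic finite automata: `autV i` recognizes `V i`, and since the tests for `U i` and `W i`
read the stack from its top, `autU i` and `autW i` recognize the reversals of `U i` and `W i`. -/
structure RuleFamily (B : Type) where
  k : ℕ
  U : Fin k → Language B
  V : Fin k → Language B
  W : Fin k → Language B
  SU : Fin k → Type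
  SV : Fin k → Type
  SW : Fin k → Type
  finiteU : ∀ i, Finite (SU i)
  finiteV : ∀ i, Finite (SV i)
  finiteW : ∀ i, Finite (SW i)
  autU : ∀ i, DFA B (SU i)
  autV : ∀ i, DFA B (SV i)
  autW : ∀ i, DFA B (SW i)
  autU_accepts : ∀ i, (autU i).accepts = (U i).reverse
  autV_accepts : ∀ i, (autV i).accepts = V i
  autW_accepts : ∀ i, (autW i).accepts = (W i).reverse
  /-- the languages are preprocessed such that `U i` and `V i` do not share the empty word -/
  not_nil : ∀ i, ¬ ([] ∈ U i ∧ [] ∈ V i)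
  /-- the initial state of `autW i` is never reentered, so that a player who has begun to check
  the stack content cannot return to the choice whether to check it -/
  start_not_reentered : ∀ i s b, (autW i).step s b ≠ (autW i).start

/-- The edges between vertices of `G` are described by the triples `(U, V, W)`. -/
def RuleFamily.Represents {B : Type} (R : RuleFamily B) (G : ParityGameGraph (List B)) : Prop :=
  ∀ x ∈ G.V, ∀ y ∈ G.V, G.E x y ↔
    ∃ i, ∃ u ∈ R.U i, ∃ v ∈ R.V i, ∃ w ∈ R.W i, w ++ u = x ∧ w ++ v = y

/-! ### The pushdown game graph `H` -/

/-- The auxiliary states: the states of all automata of the family, and a sink state. -/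
inductive AuxState {B : Type} (R : RuleFamily B) : Type
  | readU (i : Fin R.k) (s : R.SU i)
  | readV (i : Fin R.k) (s : R.SV i)
  | readW (i : Fin R.k) (s : R.SW i)
  | sink

instance {B : Type} (R : RuleFamily B) : Finite (AuxState R) := by
  have := R.finiteU
  have := R.finiteV
  have := R.finiteW
  let f : Option ((Σ i, R.SU i) ⊕ (Σ i, R.SV i) ⊕ (Σ i, R.SW i)) → AuxState R
    | none => .sink
    | some (.inl ⟨i, s⟩) => .readU i s
    | some (.inr (.inl ⟨i, s⟩)) => .readV i s
    | some (.inr (.inr ⟨i, s⟩)) => .readW i s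
  refine Finite.of_surjective f ?_
  rintro (⟨i, s⟩ | ⟨i, s⟩ | ⟨i, s⟩ | _)
  exacts [⟨some (.inl ⟨i, s⟩), rfl⟩, ⟨some (.inr (.inl ⟨i, s⟩)), rfl⟩,
    ⟨some (.inr (.inr ⟨i, s⟩)), rfl⟩, ⟨none, rfl⟩]

section Construction

variable {A QI QII : Type} (R : RuleFamily (A ⊕ (QI ⊕ QII)))

/-- The states of Player I in `H`: the set `Q_I ∪ S_I`. -/
abbrev HStateI : Type := QI ⊕ AuxState R

/-- The states of Player II in `H`: the set `Q_II ∪ S_II`. -/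
abbrev HStateII : Type := QII ⊕ AuxState R

/-- The control states of `H`. -/
abbrev HState : Type := HStateI R ⊕ HStateII R

/-- The alphabet `C = A ∪ Q_I ∪ Q_II ∪ S_I ∪ S_II`. -/
abbrev HAlphabet : Type := A ⊕ HState R

variable {R} in
/-- The control states of `G` as control states of `H`. -/
def gState : QI ⊕ QII → HState R
  | .inl q => .inl (.inl q)
  | .inr q => .inr (.inl q)

variable {R} in
/-- The copy of an auxiliary state that belongs to the given player. -/
def auxState : Player → AuxState R → HState R
  | .one, s => .inl (.inr s)
  | .two, s => .inr (.inr s)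

variable {R} in
/-- The control state of the sink in which the given player wins.  It belongs to the opponent. -/
def winState (P : Player) : HState R := auxState P.other .sink

/-- The player who owns a control state of `G`. -/
def owner : QI ⊕ QII → Player
  | .inl _ => .one
  | .inr _ => .two

/-- The rules for the micro-steps.  A rule `p → q` that leaves the stack unchanged is
written as the family of rules `⟨top, p, top.toList, q⟩`. -/
inductive MicroRule : PushdownRule A (HState R) → Prop
  /-- at a vertex of `G`, its owner chooses an index `i` and `autU i` reads the control state -/
  | choose (q : QI ⊕ QII) (i : Fin R.k) (top : Option A) :
      MicroRule ⟨top, gState q, top.toList,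
        auxState (owner q) (.readU i ((R.autU i).step (R.autU i).start (.inr q)))⟩
  /-- the mover `P` pops a letter, which is read by `autU i` -/
  | popU (P : Player) (i : Fin R.k) (s : R.SU i) (a : A) :
      MicroRule ⟨some a, auxState P (.readU i s), [],
        auxState P (.readU i ((R.autU i).step s (.inl a)))⟩
  | bottomU (P : Player) (i : Fin R.k) (s : R.SU i) :
      MicroRule ⟨none, auxState P (.readU i s), [], auxState P (.readU i s)⟩
  /-- in an accepting state of `autU i`, the mover `P` may give the turn to the opponent -/
  | turn (P : Player) (i : Fin R.k) (s : R.SU i) (hs : s ∈ (R.autU i).accept) (top : Option A) :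
      MicroRule ⟨top, auxState P (.readU i s), top.toList,
        auxState P.other (.readW i (R.autW i).start)⟩
  /-- the opponent `P` of the mover checks the stack content with `autW i`, emptying the stack -/
  | popW (P : Player) (i : Fin R.k) (s : R.SW i) (a : A) :
      MicroRule ⟨some a, auxState P (.readW i s), [],
        auxState P (.readW i ((R.autW i).step s (.inl a)))⟩
  /-- the check is successful: the mover wins -/
  | acceptW (P : Player) (i : Fin R.k) (s : R.SW i) (hs : s ∈ (R.autW i).accept) :
      MicroRule ⟨none, auxState P (.readW i s), [], winState P.other⟩
  /-- the check fails: the opponent `P` of the mover wins -/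
  | rejectW (P : Player) (i : Fin R.k) (s : R.SW i) (hs : s ∉ (R.autW i).accept) :
      MicroRule ⟨none, auxState P (.readW i s), [], winState P⟩
  /-- instead of checking, the opponent `P` of the mover lets the mover proceed -/
  | proceed (P : Player) (i : Fin R.k) (top : Option A) :
      MicroRule ⟨top, auxState P (.readW i (R.autW i).start), top.toList,
        auxState P.other (.readV i (R.autV i).start)⟩
  /-- the mover `P` pushes a letter, which is read by `autV i` -/
  | pushV (P : Player) (i : Fin R.k) (s : R.SV i) (a : A) (top : Option A) :
      MicroRule ⟨top, auxState P (.readV i s), top.toList ++ [a],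
        auxState P (.readV i ((R.autV i).step s (.inl a)))⟩
  /-- the mover `P` enters a vertex of `G` if `autV i` accepts after reading its control state -/
  | leave (P : Player) (i : Fin R.k) (s : R.SV i) (q : QI ⊕ QII)
      (hs : (R.autV i).step s (.inr q) ∈ (R.autV i).accept) (top : Option A) :
      MicroRule ⟨top, auxState P (.readV i s), top.toList, gState q⟩
  | sink (P : Player) (top : Option A) :
      MicroRule ⟨top, winState P, top.toList, winState P⟩

/-- The rules of `H`: the rules for the micro-steps, and self-loops that avoid deadlocks where no
other rule is applicable. -/
def hRules : Set (PushdownRule A (HState R)) :=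
  {r | MicroRule R r} ∪
    {r | (∀ r', MicroRule R r' → ¬ (r'.top = r.top ∧ r'.src = r.src)) ∧
      r.push = r.top.toList ∧ r.tgt = r.src}

/-- Vertices of `G` keep their color, shifted by 2; the auxiliary states of Player I have color 0
and those of Player II have color 1. -/
def hColor (c : QI ⊕ QII → ℕ) : HState R → ℕ
  | .inl (.inl q) => c (.inl q) + 2
  | .inr (.inl q) => c (.inr q) + 2
  | .inl (.inr _) => 0
  | .inr (.inr _) => 1

theorem hRules_finite [Finite A] [Finite QI] [Finite QII] : (hRules R).Finite := by
  have hle : ∀ r ∈ hRules R, r.push.length ≤ 2 := by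
    have ht : ∀ t : Option A, t.toList.length ≤ 1 := by rintro (_ | _) <;> simp
    rintro r (h | ⟨-, h, -⟩)
    · cases h <;> first
        | exact (ht _).trans one_le_two
        | exact Nat.zero_le _
        | (rw [List.length_append, List.length_singleton]
           exact Nat.succ_le_succ (ht _))
    · rw [h]
      exact (ht _).trans one_le_two
  have hfin : (Set.univ ×ˢ Set.univ ×ˢ {l : List A | l.length ≤ 2} ×ˢ Set.univ :
      Set (Option A × HState R × List A × HState R)).Finite :=
    Set.finite_univ.prod (Set.finite_univ.prod ((List.finite_length_le A 2).prod Set.finite_univ))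
  refine (hfin.image fun x => ⟨x.1, x.2.1, x.2.2.1, x.2.2.2⟩).subset ?_
  rintro ⟨t, p, v, q⟩ hr
  exact ⟨(t, p, v, q), ⟨trivial, trivial, hle _ hr, trivial⟩, rfl⟩

/-- The pushdown parity game system that defines `H`. -/
def hSystem [Finite A] [Finite QI] [Finite QII] (c : QI ⊕ QII → ℕ) :
    PushdownSystem A (HStateI R) (HStateII R) where
  rules := hRules R
  rules_finite := hRules_finite R
  exists_rule := by
    intro top p
    by_cases h : ∃ r, MicroRule R r ∧ r.top = top ∧ r.src = p
    · obtain ⟨r, hr, h⟩ := h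
      exact ⟨r, Or.inl hr, h⟩
    · exact ⟨⟨top, p, top.toList, p⟩, Or.inr ⟨fun r' hr' h' => h ⟨r', hr', h'⟩, rfl, rfl⟩,
        rfl, rfl⟩
  color := hColor R c

/-- The pushdown parity game graph `H` over the alphabet `C` that is constructed from `G` and from
a representation of its edges. -/
def hGraph [Finite A] [Finite QI] [Finite QII] (G : ParityGameGraph (List (A ⊕ (QI ⊕ QII)))) :
    ParityGameGraph (List (HAlphabet R)) :=
  (hSystem R fun q => G.color (vertex [] q)).graph

/-- Words over `B` as words over `C`. -/
def embed : List (A ⊕ (QI ⊕ QII)) → List (HAlphabet R) := List.map (Sum.map id gState)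

end Construction

end MSOGame

open MSOGame

/-! An edge of `G` replaces a suffix `uq` of a vertex by `vq'` and keeps the prefix `w`. In `H` it
becomes a protocol: the mover pops `uq` while `autU i` reads it, claims that the remaining stack `w`
lies in `W i` and, unless the opponent checks this claim, pushes `vq'` along `autV i`.

A winning strategy `τ` of `P` in `H` must play this protocol properly. The auxiliary states of a
player carry the color that is bad for this player, so `τ` cannot stay in a popping or pushing phase
forever (`exists_leave`). The opponent is free to check, so the claims of `P` are true
(`accept_of_opponent_check`). If a claim of the opponent is true, checking it would lose, so `τ`
lets the opponent proceed (`strategy_eq_proceed`).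

Hence `σ` may send `x` to the vertex of `G` that is reached from `x` when `P` follows `τ` and the
opponent does not check (`exists_macroStep`, `MacroStep.unique`). Each play compatible with `σ`
lifts to a play of `H` compatible with `τ`; the moves of the opponent are lifted by
`exists_path_of_opponent_move`. Colors of `G` are shifted by 2 and auxiliary colors are at most 1,
so both plays have the same winner (`wonBy_iff_of_color`).

For definability, reaching a vertex by such steps is a reflexive transitive closure, hence
MSO-expressible over the alphabet of `H`. Coding the control states of `H` by words over the
alphabet of `G` transfers the formula (`exists_interpretation`). At vertices of `G` that no play
compatible with `τ` visits, the formula may fail to give a unique successor; there a definable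
choice of an edge is used (`exists_definable_choice`). Without stack letters the code is not
available, but then `G` is finite. -/

open MSOGame
namespace MSOGame

/-! ### Definable predicates -/

/-- A predicate on valuations is definable if it is expressed by an MSO-formula. -/
def MSODef {Sg : Type} (n m : ℕ) (R : (Fin n → List Sg) → (Fin m → Set (List Sg)) → Prop) : Prop :=
  ∃ φ : MSO Sg n m, ∀ ρ S, φ.Sat ρ S ↔ R ρ S

/-- Definable binary relations between words. -/
def MSODef₂ {Sg : Type} (R : List Sg → List Sg → Prop) : Prop :=
  ∃ φ : MSO Sg 2 0, ∀ x y, φ.Holds₂ x y ↔ R x y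

section Closure

variable {Sg : Type} {n m : ℕ} {R R' : (Fin n → List Sg) → (Fin m → Set (List Sg)) → Prop}

theorem MSODef.congr (h : MSODef n m R) (h' : ∀ ρ S, R' ρ S ↔ R ρ S) : MSODef n m R' := by
  obtain ⟨φ, hφ⟩ := h
  exact ⟨φ, fun ρ S => (hφ ρ S).trans (h' ρ S).symm⟩

theorem MSODef.not (h : MSODef n m R) : MSODef n m fun ρ S => ¬ R ρ S := by
  obtain ⟨φ, hφ⟩ := h
  exact ⟨.neg φ, fun ρ S => not_congr (hφ ρ S)⟩

theorem MSODef.and (h : MSODef n m R) (h' : MSODef n m R') :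
    MSODef n m fun ρ S => R ρ S ∧ R' ρ S := by
  obtain ⟨φ, hφ⟩ := h
  obtain ⟨ψ, hψ⟩ := h'
  exact ⟨.and φ ψ, fun ρ S => and_congr (hφ ρ S) (hψ ρ S)⟩

theorem MSODef.or (h : MSODef n m R) (h' : MSODef n m R') :
    MSODef n m fun ρ S => R ρ S ∨ R' ρ S :=
  (h.not.and h'.not).not.congr fun ρ S => by tauto

theorem MSODef.imp (h : MSODef n m R) (h' : MSODef n m R') :
    MSODef n m fun ρ S => R ρ S → R' ρ S :=
  (h.and h'.not).not.congr fun ρ S => by tauto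

/-- The quantified word is a separate argument of `R`. Inside the quantifier it is `ρ 0`, and the
outer variables have moved up by one; this explains the shifted indices in later uses of `at`. -/
theorem MSODef.exNode {R : (Fin n → List Sg) → (Fin m → Set (List Sg)) → List Sg → Prop}
    (h : MSODef (n + 1) m fun ρ S => R (Fin.tail ρ) S (ρ 0)) :
    MSODef n m fun ρ S => ∃ w, R ρ S w := by
  obtain ⟨φ, hφ⟩ := h
  refine ⟨.exNode φ, fun ρ S => exists_congr fun w => hφ (Fin.cons w ρ) S⟩

theorem MSODef.allNode {R : (Fin n → List Sg) → (Fin m → Set (List Sg)) → List Sg → Prop}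
    (h : MSODef (n + 1) m fun ρ S => R (Fin.tail ρ) S (ρ 0)) :
    MSODef n m fun ρ S => ∀ w, R ρ S w :=
  (MSODef.exNode (R := fun ρ S w => ¬ R ρ S w) h.not).not.congr fun ρ S => by simp

theorem MSODef.exSet {R : (Fin n → List Sg) → (Fin m → Set (List Sg)) → Set (List Sg) → Prop}
    (h : MSODef n (m + 1) fun ρ S => R ρ (Fin.tail S) (S 0)) :
    MSODef n m fun ρ S => ∃ X, R ρ S X := by
  obtain ⟨φ, hφ⟩ := h
  refine ⟨.exSet φ, fun ρ S => exists_congr fun w => hφ ρ (Fin.cons w S)⟩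

theorem MSODef.allSet {R : (Fin n → List Sg) → (Fin m → Set (List Sg)) → Set (List Sg) → Prop}
    (h : MSODef n (m + 1) fun ρ S => R ρ (Fin.tail S) (S 0)) :
    MSODef n m fun ρ S => ∀ X, R ρ S X :=
  (MSODef.exSet (R := fun ρ S w => ¬ R ρ S w) h.not).not.congr fun ρ S => by simp

theorem MSODef.eq (i j : Fin n) : MSODef (Sg := Sg) n m fun ρ _ => ρ i = ρ j :=
  ⟨.eq i j, fun _ _ => Iff.rfl⟩

theorem MSODef.mem (i : Fin n) (j : Fin m) : MSODef (Sg := Sg) n m fun ρ S => ρ i ∈ S j :=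
  ⟨.mem i j, fun _ _ => Iff.rfl⟩

theorem MSODef.true : MSODef (Sg := Sg) n m fun _ _ => True :=
  -- There may be no free node variable, so the trivial equation needs a bound one.
  (MSODef.exNode (R := fun _ _ w => w = w) (MSODef.eq 0 0)).congr fun _ _ => by simp

theorem MSODef.const (p : Prop) : MSODef (Sg := Sg) n m fun _ _ => p := by
  by_cases hp : p
  · exact MSODef.true.congr fun _ _ => by simp [hp]
  · exact MSODef.true.not.congr fun _ _ => by simp [hp]

theorem MSODef.exFinite {ι : Type} [Finite ι]
    {R : ι → (Fin n → List Sg) → (Fin m → Set (List Sg)) → Prop} (h : ∀ i, MSODef n m (R i)) :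
    MSODef n m fun ρ S => ∃ i, R i ρ S := by
  suffices ∀ s : Set ι, s.Finite → MSODef n m fun ρ S => ∃ i ∈ s, R i ρ S from
    (this Set.univ Set.finite_univ).congr fun ρ S => by simp
  intro s hs
  induction s, hs using Set.Finite.induction_on with
  | empty => exact (MSODef.const False).congr fun ρ S => by simp
  | @insert a s _ _ ih => exact ((h a).or ih).congr fun ρ S => by simp

theorem MSODef.allFinite {ι : Type} [Finite ι]
    {R : ι → (Fin n → List Sg) → (Fin m → Set (List Sg)) → Prop} (h : ∀ i, MSODef n m (R i)) :
    MSODef n m fun ρ S => ∀ i, R i ρ S :=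
  (MSODef.exFinite fun i => (h i).not).not.congr fun ρ S => by simp

/-- Allows a formula to be used inside larger contexts. All renamings are treated at once because
the induction extends them under quantifiers. -/
theorem MSO.exists_rename (φ : MSO Sg n m) : ∀ {n' m' : ℕ} (f : Fin n → Fin n')
    (g : Fin m → Fin m'), MSODef n' m' fun ρ S => φ.Sat (ρ ∘ f) (S ∘ g) := by
  induction φ with
  | eq x y => exact fun f g => ⟨.eq (f x) (f y), fun ρ S => Iff.rfl⟩
  | succ a x y => exact fun f g => ⟨.succ a (f x) (f y), fun ρ S => Iff.rfl⟩
  | mem x X => exact fun f g => ⟨.mem (f x) (g X), fun ρ S => Iff.rfl⟩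
  | neg φ ih => exact fun f g => (ih f g).not
  | and φ ψ ih ih' => exact fun f g => (ih f g).and (ih' f g)
  | exNode φ ih =>
    refine fun f g => MSODef.exNode ((ih (Fin.cons 0 (Fin.succ ∘ f)) g).congr fun ρ S => ?_)
    refine iff_of_eq (congrArg (fun r => MSO.Sat φ r _) (funext fun i => ?_))
    refine Fin.cases ?_ (fun i => ?_) i <;> simp [Fin.tail]
  | exSet φ ih =>
    refine fun f g => MSODef.exSet ((ih f (Fin.cons 0 (Fin.succ ∘ g))).congr fun ρ S => ?_)
    refine iff_of_eq (congrArg (fun r => MSO.Sat φ _ r) (funext fun i => ?_))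
    refine Fin.cases ?_ (fun i => ?_) i <;> simp [Fin.tail]

theorem MSODef₂.at {R : List Sg → List Sg → Prop} (h : MSODef₂ R) (i j : Fin n) :
    MSODef n m fun ρ _ => R (ρ i) (ρ j) := by
  obtain ⟨φ, hφ⟩ := h
  refine (φ.exists_rename ![i, j] ![]).congr fun ρ S => ?_
  rw [← hφ, MSO.Holds₂]
  refine iff_of_eq (congrArg₂ (MSO.Sat φ) (funext fun i => ?_) (Subsingleton.elim _ _))
  refine Fin.cases rfl (fun i => ?_) i
  exact Fin.cases rfl (fun i => i.elim0) i

theorem MSODef.def₂ {R : List Sg → List Sg → Prop} (h : MSODef 2 0 fun ρ _ => R (ρ 0) (ρ 1)) :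
    MSODef₂ R := by
  obtain ⟨φ, hφ⟩ := h
  exact ⟨φ, fun x y => hφ _ _⟩

theorem MSODef₂.congr {R R' : List Sg → List Sg → Prop} (h : MSODef₂ R)
    (h' : ∀ x y, R' x y ↔ R x y) : MSODef₂ R' := by
  obtain ⟨φ, hφ⟩ := h
  exact ⟨φ, fun x y => (hφ x y).trans (h' x y).symm⟩

/-- Set quantification expresses reachability: `y` lies in every `R`-closed set that contains `x`,
the smallest one being the set of words reachable from `x`. -/
theorem MSODef₂.reflTransGen {R : List Sg → List Sg → Prop} (h : MSODef₂ R) :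
    MSODef₂ (Relation.ReflTransGen R) := by
  have key : MSODef₂ fun x y => ∀ X : Set (List Sg),
      (x ∈ X ∧ ∀ z z', z ∈ X ∧ R z z' → z' ∈ X) → y ∈ X := by
    refine MSODef.def₂ (MSODef.allSet (R := fun ρ _ X =>
      (ρ 0 ∈ X ∧ ∀ z z', z ∈ X ∧ R z z' → z' ∈ X) → ρ 1 ∈ X) ?_)
    refine ((MSODef.mem 0 0).and ?_).imp (MSODef.mem 1 0)
    refine MSODef.allNode (R := fun _ S z => ∀ z', z ∈ S 0 ∧ R z z' → z' ∈ S 0) ?_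
    refine MSODef.allNode (R := fun ρ S z' => ρ 0 ∈ S 0 ∧ R (ρ 0) z' → z' ∈ S 0) ?_
    exact ((MSODef.mem 1 0).and (h.at 1 0)).imp (MSODef.mem 0 0)
  refine key.congr fun x y => ⟨fun hxy X hX => ?_, fun hX => ?_⟩
  · induction hxy with
    | refl => exact hX.1
    | tail _ hbc ih => exact hX.2 _ _ ⟨ih, hbc⟩
  · exact hX {z | Relation.ReflTransGen R x z} ⟨.refl, fun z z' hz => hz.1.tail hz.2⟩

theorem MSODef₂.append (v : List Sg) : MSODef₂ fun x y => y = x ++ v := by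
  induction v with
  | nil => exact MSODef.def₂ ((MSODef.eq 1 0).congr fun ρ S => by simp)
  | cons a v ih =>
    have key : MSODef₂ fun x y => ∃ z, x ++ [a] = z ∧ y = z ++ v := by
      refine MSODef.def₂ (MSODef.exNode (R := fun ρ _ z => ρ 0 ++ [a] = z ∧ ρ 1 = z ++ v) ?_)
      exact MSODef.and ⟨.succ a 1 0, fun ρ S => Iff.rfl⟩ (ih.at 0 2)
    exact key.congr fun x y => by simp

/-- Only the empty word is no successor; finiteness of the alphabet turns the choice of the last
letter into a finite disjunction. -/
theorem MSODef.eq_nil [Finite Sg] (i : Fin n) :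
    MSODef (Sg := Sg) n m fun ρ _ => ρ i = [] := by
  have key : MSODef (Sg := Sg) n m fun ρ _ => ∃ z, ∃ a : Sg, ρ i = z ++ [a] :=
    MSODef.exNode (R := fun ρ _ z => ∃ a : Sg, ρ i = z ++ [a])
      (MSODef.exFinite fun a => (MSODef₂.append [a]).at 0 i.succ)
  refine key.not.congr fun ρ S => ?_
  rcases List.eq_nil_or_concat (ρ i) with h | ⟨w, a, h⟩ <;> simp [h]

theorem MSODef.eq_const [Finite Sg] (i : Fin n) (v : List Sg) :
    MSODef (Sg := Sg) n m fun ρ _ => ρ i = v := by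
  have key : MSODef (Sg := Sg) n m fun ρ _ => ∃ z, z = [] ∧ ρ i = z ++ v :=
    MSODef.exNode (R := fun ρ _ z => z = [] ∧ ρ i = z ++ v)
      ((MSODef.eq_nil 0).and ((MSODef₂.append v).at 0 i.succ))
  exact key.congr fun ρ S => by simp

theorem MSODef₂.prefix [Finite Sg] : MSODef₂ fun x y : List Sg => x <+: y := by
  have key : MSODef₂ fun x y : List Sg => ∃ a : Sg, y = x ++ [a] :=
    MSODef.def₂ (MSODef.exFinite fun a => (MSODef₂.append [a]).at 0 1)
  refine key.reflTransGen.congr fun x y => ⟨?_, fun h => ?_⟩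
  · rintro ⟨v, rfl⟩
    induction v using List.reverseRecOn with
    | nil => simpa using Relation.ReflTransGen.refl
    | append_singleton v a ih => exact ih.tail ⟨a, by simp⟩
  · induction h with
    | refl => exact List.prefix_rfl
    | tail _ hbc ih =>
      obtain ⟨a, rfl⟩ := hbc
      exact ih.trans (List.prefix_append _ _)

end Closure

/-! ### Interpretation of a tree structure in another one by a code -/

section Interpretation

variable {B C : Type}

/-- The codes of words are what is reachable from the empty word by appending code words. -/
theorem MSODef.mem_range_flatMap [Finite B] [Finite C] (code : C → List B) {n m : ℕ} (i : Fin n) :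
    MSODef n m fun ρ _ => ∃ x : List C, ρ i = x.flatMap code := by
  have step : MSODef₂ fun y z : List B => ∃ c : C, z = y ++ code c :=
    MSODef.def₂ (MSODef.exFinite fun c => (MSODef₂.append (code c)).at 0 1)
  have key : MSODef n m fun ρ _ => ∃ y : List B, y = [] ∧
      Relation.ReflTransGen (fun y z : List B => ∃ c : C, z = y ++ code c) y (ρ i) :=
    MSODef.exNode (R := fun ρ _ y => y = [] ∧
      Relation.ReflTransGen (fun y z : List B => ∃ c : C, z = y ++ code c) y (ρ i))
      ((MSODef.eq_nil 0).and (step.reflTransGen.at 0 i.succ))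
  refine key.congr fun ρ S => ⟨?_, ?_⟩
  · rintro ⟨x, hx⟩
    refine ⟨[], rfl, hx ▸ ?_⟩
    clear hx
    induction x using List.reverseRecOn with
    | nil => exact .refl
    | append_singleton x c ih => exact ih.tail ⟨c, by simp⟩
  · rintro ⟨_, rfl, h⟩
    generalize ρ i = y at h ⊢
    induction h with
    | refl => exact ⟨[], rfl⟩
    | tail _ hbc ih =>
      obtain ⟨c, rfl⟩ := hbc
      obtain ⟨x, rfl⟩ := ih
      exact ⟨x ++ [c], by simp⟩

/-- Node quantifiers are relativized to the set of codes. Set quantifiers need no relativization: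
only the preimage of a set under the code matters and, by injectivity, each set of words over `C` is
the preimage of its image. -/
theorem MSO.exists_interpretation [Finite B] [Finite C] {code : C → List B}
    (hcode : Function.Injective (List.flatMap code)) {n m : ℕ} (φ : MSO C n m) :
    ∃ φ' : MSO B n m, ∀ ρ S, φ'.Sat (fun i => (ρ i).flatMap code) S ↔
      φ.Sat ρ fun j => List.flatMap code ⁻¹' S j := by
  induction φ with
  | eq x y => exact ⟨.eq x y, fun ρ S => hcode.eq_iff⟩
  | succ a x y =>
    obtain ⟨φ', h⟩ := (MSODef₂.append (code a)).at x y
    refine ⟨φ', fun ρ S => (h _ _).trans ?_⟩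
    change _ ↔ ρ x ++ [a] = ρ y
    rw [← hcode.eq_iff]
    simp [eq_comm]
  | mem x X => exact ⟨.mem x X, fun ρ S => Iff.rfl⟩
  | neg φ ih =>
    obtain ⟨φ', h⟩ := ih
    exact ⟨.neg φ', fun ρ S => not_congr (h ρ S)⟩
  | and φ ψ ih ih' =>
    obtain ⟨φ', h⟩ := ih
    obtain ⟨ψ', h'⟩ := ih'
    exact ⟨.and φ' ψ', fun ρ S => and_congr (h ρ S) (h' ρ S)⟩
  | @exNode n m φ ih =>
    obtain ⟨φ', h⟩ := ih
    obtain ⟨δ, hδ⟩ := MSODef.mem_range_flatMap code (m := m) (0 : Fin (n + 1))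
    have hcons : ∀ (ρ : Fin n → List C) (x : List C),
        (Fin.cons (x.flatMap code) fun i => (ρ i).flatMap code : Fin (n + 1) → List B) =
          fun i => ((Fin.cons x ρ : Fin (n + 1) → List C) i).flatMap code := by
      intro ρ x
      funext i
      refine Fin.cases rfl (fun i => rfl) i
    refine ⟨.exNode (.and δ φ'), fun ρ S => ⟨?_, ?_⟩⟩
    · rintro ⟨w, hw, hφ⟩
      obtain ⟨x, hx⟩ := (hδ _ _).1 hw
      rw [Fin.cons_zero] at hx
      subst hx
      rw [hcons, h] at hφ
      exact ⟨x, hφ⟩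
    · rintro ⟨x, hx⟩
      refine ⟨x.flatMap code, (hδ _ _).2 ⟨x, rfl⟩, ?_⟩
      rw [hcons, h]
      exact hx
  | @exSet n m φ ih =>
    obtain ⟨φ', h⟩ := ih
    have hcons : ∀ (S : Fin m → Set (List B)) (X : Set (List B)),
        (fun j => List.flatMap code ⁻¹' (Fin.cons X S : Fin (m + 1) → Set (List B)) j) =
          (Fin.cons (List.flatMap code ⁻¹' X) fun j => List.flatMap code ⁻¹' S j) := by
      intro S X
      funext i
      refine Fin.cases rfl (fun i => rfl) i
    refine ⟨.exSet φ', fun ρ S => ⟨?_, ?_⟩⟩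
    · rintro ⟨X, hX⟩
      rw [h, hcons] at hX
      exact ⟨_, hX⟩
    · rintro ⟨X, hX⟩
      refine ⟨List.flatMap code '' X, ?_⟩
      rw [h, hcons, Set.preimage_image_eq _ hcode]
      exact hX

theorem MSODef₂.interpret [Finite B] [Finite C] {code : C → List B}
    (hcode : Function.Injective (List.flatMap code)) {R : List C → List C → Prop}
    (h : MSODef₂ R) : ∃ R' : List B → List B → Prop, MSODef₂ R' ∧
      ∀ x y, R' (x.flatMap code) (y.flatMap code) ↔ R x y := by
  obtain ⟨φ, hφ⟩ := h
  obtain ⟨φ', h⟩ := φ.exists_interpretation hcode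
  refine ⟨fun x y => φ'.Holds₂ x y, ⟨φ', fun _ _ => Iff.rfl⟩, fun x y => ?_⟩
  rw [← hφ]
  unfold MSO.Holds₂
  rw [Subsingleton.elim (![] : Fin 0 → Set (List C)) fun j => List.flatMap code ⁻¹' ![] j, ← h]
  refine iff_of_eq (congrArg₂ (MSO.Sat φ') (funext fun i => ?_) (Subsingleton.elim _ _))
  refine Fin.cases rfl (fun i => ?_) i
  exact Fin.cases rfl (fun i => i.elim0) i

/-- The code that keeps the letters of `A` and maps a letter `p` of `P` to a word `bⁿ a` whose
length determines `p`. -/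
def stackCode {A P Q : Type} (a : A) (b : Q) (e : P → ℕ) : A ⊕ P → List (A ⊕ Q)
  | .inl x => [.inl x]
  | .inr p => List.replicate (e p + 1) (.inr b) ++ [.inl a]

/-- Decoding from the left is unambiguous: the `+ 1` makes the code of a letter of `P` start with
`b`, unlike that of a letter of `A`, and the first `a` after the block of `b` marks its end. -/
theorem stackCode_flatMap_injective {A P Q : Type} (a : A) (b : Q) {e : P → ℕ}
    (he : Function.Injective e) : Function.Injective (List.flatMap (stackCode a b e)) := by
  have hrep : ∀ (i j : ℕ) (x y : List (A ⊕ Q)),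
      List.replicate i (Sum.inr b) ++ (Sum.inl a :: x) =
        List.replicate j (Sum.inr b) ++ (Sum.inl a :: y) → i = j ∧ x = y := by
    intro i
    induction i with
    | zero => rintro (_ | j) x y h <;> simp_all [List.replicate_succ]
    | succ i ih =>
      rintro (_ | j) x y h
      · simp [List.replicate_succ] at h
      · obtain ⟨rfl, rfl⟩ := ih j x y (by simpa [List.replicate_succ] using h)
        exact ⟨rfl, rfl⟩
  intro x
  induction x with
  | nil => rintro (_ | ⟨_ | _, y⟩) h <;> simp [stackCode] at h ⊢
  | cons c x ih =>
    rintro (_ | ⟨d, y⟩) h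
    · rcases c with c | c <;> simp [stackCode] at h
    · rcases c with c | c <;> rcases d with d | d
      · simp only [List.flatMap_cons, stackCode, List.singleton_append, List.cons.injEq,
          Sum.inl.injEq] at h
        rw [h.1, ih h.2]
      · simp [stackCode, List.replicate_succ] at h
      · simp [stackCode, List.replicate_succ] at h
      · simp only [List.flatMap_cons, stackCode, List.append_assoc, List.singleton_append] at h
        obtain ⟨h₁, h₂⟩ := hrep _ _ _ _ h
        rw [he (Nat.succ_injective h₁), ih h₂]

end Interpretation

/-! ### Plays that are compatible with a memoryless strategy -/

@[simp]
theorem Player.other_other (P : Player) : P.other.other = P := by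
  cases P <;> rfl

theorem Player.other_ne (P : Player) : P.other ≠ P := by
  cases P <;> simp [Player.other]

/-- The color `0` or `1` whose parity is bad for the given player. -/
def Player.losingColor : Player → ℕ
  | .one => 0
  | .two => 1

theorem Player.losingColor_le_one (P : Player) : P.losingColor ≤ 1 := by
  cases P <;> simp [Player.losingColor]

namespace ParityGameGraph

variable {α : Type} (H : ParityGameGraph α)

/-- The edges that are compatible with the strategy `τ` of player `P`. -/
def CompatibleEdge (P : Player) (τ : α → α) (u v : α) : Prop :=
  H.E u v ∧ (u ∈ H.ownedBy P → v = τ u)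

/-- The vertices on plays from `u₀` that are compatible with the strategy `τ` of player `P`. -/
def CompatiblyReachable (P : Player) (τ : α → α) (u₀ u : α) : Prop :=
  Relation.ReflTransGen (H.CompatibleEdge P τ) u₀ u

variable {H}

theorem CompatiblyReachable.reachable {P : Player} {τ : α → α} {u₀ u : α}
    (h : H.CompatiblyReachable P τ u₀ u) : H.ReachableFrom u₀ u := by
  unfold CompatiblyReachable at h
  induction h with
  | refl => exact .refl
  | tail _ h ih => exact ih.tail h.1

theorem CompatiblyReachable.edge_strategy {P : Player} {τ : α → α} {u₀ u : α}
    (hτ : H.IsMemorylessStrategy P u₀ τ) (h : H.CompatiblyReachable P τ u₀ u)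
    (hu : u ∈ H.ownedBy P) : H.E u (τ u) :=
  hτ u hu h.reachable

theorem CompatiblyReachable.strategy {P : Player} {τ : α → α} {u₀ u : α}
    (hτ : H.IsMemorylessStrategy P u₀ τ) (h : H.CompatiblyReachable P τ u₀ u)
    (hu : u ∈ H.ownedBy P) : H.CompatiblyReachable P τ u₀ (τ u) :=
  h.tail ⟨h.edge_strategy hτ hu, fun _ => rfl⟩

theorem not_mem_ownedBy_other {P : Player} {u : α} (hu : u ∈ H.ownedBy P.other) :
    u ∉ H.ownedBy P := by
  cases P
  · exact Set.disjoint_right.1 H.disjoint hu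
  · exact Set.disjoint_left.1 H.disjoint hu

theorem mem_ownedBy_or_other (P : Player) {u : α} (hu : u ∈ H.V) :
    u ∈ H.ownedBy P ∨ u ∈ H.ownedBy P.other := by
  cases P
  · exact hu
  · exact hu.symm

theorem mem_V_of_mem_ownedBy {P : Player} {u : α} (hu : u ∈ H.ownedBy P) : u ∈ H.V := by
  cases P
  · exact Or.inl hu
  · exact Or.inr hu

theorem compatibleEdge_of_other {P : Player} {τ : α → α} {u v : α} (hu : u ∈ H.ownedBy P.other)
    (h : H.E u v) : H.CompatibleEdge P τ u v :=
  ⟨h, fun hu' => (not_mem_ownedBy_other hu hu').elim⟩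

theorem parityCondition_succ (π : ℕ → α) :
    H.ParityCondition (fun n => π (n + 1)) ↔ H.ParityCondition π := by
  have key : ∀ c, (∃ᶠ n in Filter.atTop, H.color (π (n + 1)) = c) ↔
      ∃ᶠ n in Filter.atTop, H.color (π n) = c := by
    intro c
    conv_rhs => rw [← Filter.map_add_atTop_eq_nat 1]
    rw [Filter.frequently_map]
  simp only [ParityCondition, key]

theorem wonBy_succ (P : Player) (π : ℕ → α) :
    H.WonBy P (fun n => π (n + 1)) ↔ H.WonBy P π := by
  cases P
  · exact not_congr (parityCondition_succ π)
  · exact parityCondition_succ π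

theorem not_wonBy_of_color_eq {P : Player} {π : ℕ → α}
    (h : ∀ n, H.color (π n) = P.losingColor) : ¬ H.WonBy P π := by
  have key : {c | ∃ᶠ n in Filter.atTop, H.color (π n) = c} = {P.losingColor} := by
    ext c
    simp only [h, Set.mem_ofPred_eq, Set.mem_singleton_iff, Filter.frequently_const]
    exact eq_comm
  cases P
  · exact fun hw => hw ⟨0, by rw [key]; exact isGreatest_singleton, by simp⟩
  · rintro ⟨m, hm, heven⟩
    rw [key] at hm
    obtain rfl : m = 1 := hm.1
    simp at heven

/-- The winner does not change when the path from `u₀` to `u` is put in front of the play, one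
vertex at a time. -/
theorem IsWinningStrategy.wonBy {P : Player} {τ : α → α} {u₀ : α}
    (hτ : H.IsWinningStrategy P u₀ τ) {u : α} (hu : H.CompatiblyReachable P τ u₀ u) :
    ∀ π : ℕ → α, π 0 = u → (∀ n, H.CompatibleEdge P τ (π n) (π (n + 1))) → H.WonBy P π := by
  induction hu with
  | refl => exact fun π h₀ h => hτ.2 π ⟨h₀, fun n => (h n).1⟩ fun n => (h n).2
  | @tail b c _ hbc ih =>
    intro π h₀ h
    refine (wonBy_succ P (fun n => Nat.casesOn n b π : ℕ → α)).2 (ih _ rfl ?_)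
    rintro (_ | n)
    · change H.CompatibleEdge P τ b (π 0)
      rwa [h₀]
    · exact h n

/-- A winning strategy leads out of each set of vertices that have a losing color. -/
theorem IsWinningStrategy.exists_leave {P : Player} {τ : α → α} {u₀ : α}
    (hτ : H.IsWinningStrategy P u₀ τ) {K : Set α} {goal : α → Prop}
    (hK : ∀ v ∈ K, v ∈ H.ownedBy P ∧ H.color v = P.losingColor)
    (hstep : ∀ v ∈ K, H.E v (τ v) → τ v ∈ K ∨ goal (τ v)) {v : α} (hv : v ∈ K)
    (hr : H.CompatiblyReachable P τ u₀ v) :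
    ∃ v', Relation.ReflTransGen (fun a b => a ∈ K ∧ b = τ a) v v' ∧ v' ∈ K ∧ goal (τ v') := by
  -- Otherwise the iterates of `τ` never leave `K` and form a compatible play of constant losing
  -- color.
  by_contra! hcon
  have hstep' : ∀ a b, a ∈ K ∧ b = τ a → H.CompatiblyReachable P τ u₀ a →
      H.CompatiblyReachable P τ u₀ b := by
    rintro a _ ⟨ha, rfl⟩ har
    exact har.strategy hτ.1 (hK a ha).1
  have key : ∀ n, Relation.ReflTransGen (fun a b => a ∈ K ∧ b = τ a) v (τ^[n] v) ∧
      τ^[n] v ∈ K ∧ H.CompatiblyReachable P τ u₀ (τ^[n] v) := by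
    intro n
    induction n with
    | zero => exact ⟨.refl, hv, hr⟩
    | succ n ih =>
      obtain ⟨h₁, h₂, h₃⟩ := ih
      rw [Function.iterate_succ_apply']
      refine ⟨h₁.tail ⟨h₂, rfl⟩, ?_, h₃.strategy hτ.1 (hK _ h₂).1⟩
      exact (hstep _ h₂ (h₃.edge_strategy hτ.1 (hK _ h₂).1)).resolve_right (hcon _ h₁ h₂)
  refine not_wonBy_of_color_eq (fun n => (hK _ (key n).2.1).2) (hτ.wonBy hr (fun n => τ^[n] v) rfl ?_)
  intro n
  simp only [Function.iterate_succ_apply']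
  exact ⟨(key n).2.2.edge_strategy hτ.1 (hK _ (key n).2.1).1, fun _ => rfl⟩

end ParityGameGraph

/-! ### Concatenation of finite paths and comparison of colors -/

theorem exists_seq_of_reflTransGen {α : Type} {r : α → α → Prop} {a b : α}
    (h : Relation.ReflTransGen r a b) :
    ∃ (n : ℕ) (f : ℕ → α), f 0 = a ∧ f n = b ∧ ∀ i < n, r (f i) (f (i + 1)) := by
  induction h using Relation.ReflTransGen.head_induction_on with
  | refl => exact ⟨0, fun _ => b, rfl, rfl, by simp⟩
  | @head a c hac _ ih =>
    obtain ⟨n, f, h₀, hn, hf⟩ := ih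
    refine ⟨n + 1, fun i => Nat.casesOn i a f, rfl, hn, ?_⟩
    rintro (_ | i) hi
    · change r a (f 0)
      rwa [h₀]
    · exact hf i (by omega)

/-- The first edge of each segment is kept apart because `x n` itself need not satisfy `aux`; it
also gives every segment positive length, so that `p` is strictly increasing. -/
theorem exists_concat_paths {α : Type} {E : α → α → Prop} {aux : α → Prop} {x : ℕ → α}
    (h : ∀ n, ∃ v, E (x n) v ∧ Relation.ReflTransGen (fun a b => aux a ∧ E a b) v (x (n + 1))) :
    ∃ (π : ℕ → α) (p : ℕ → ℕ), StrictMono p ∧ π 0 = x 0 ∧ (∀ n, E (π n) (π (n + 1))) ∧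
      (∀ n, π (p n) = x n) ∧ ∀ m, (∃ n, m = p n) ∨ aux (π m) := by
  have h' : ∀ n, ∃ (L : ℕ) (f : ℕ → α), 0 < L ∧ f 0 = x n ∧ f L = x (n + 1) ∧
      ∀ j < L, E (f j) (f (j + 1)) ∧ (0 < j → aux (f j)) := by
    intro n
    obtain ⟨v, hv, hpath⟩ := h n
    obtain ⟨L, f, h₀, hL, hf⟩ := exists_seq_of_reflTransGen hpath
    refine ⟨L + 1, fun i => Nat.casesOn i (x n) f, by omega, rfl, hL, ?_⟩
    rintro (_ | j) hj
    · refine ⟨?_, by simp⟩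
      change E (x n) (f 0)
      rwa [h₀]
    · exact ⟨(hf j (by omega)).2, fun _ => (hf j (by omega)).1⟩
  choose L f hL hf₀ hfL hf using h'
  -- A state `(n, j)` stands for position `j` of segment `n`; the end of a segment is counted as
  -- position 0 of the next one.
  let next : ℕ × ℕ → ℕ × ℕ := fun s => if s.2 + 1 < L s.1 then (s.1, s.2 + 1) else (s.1 + 1, 0)
  let s : ℕ → ℕ × ℕ := fun m => next^[m] (0, 0)
  have hs : ∀ m, s (m + 1) = next (s m) := fun m => Function.iterate_succ_apply' _ _ _
  let p : ℕ → ℕ := fun n => ∑ i ∈ Finset.range n, L i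
  have hp : ∀ n, p (n + 1) = p n + L n := fun n => Finset.sum_range_succ _ _
  have hmono : StrictMono p := strictMono_nat_of_lt_succ fun n => by
    rw [hp]
    exact Nat.lt_add_of_pos_right (hL n)
  have hinv : ∀ m, (s m).2 < L (s m).1 ∧ p (s m).1 + (s m).2 = m := by
    intro m
    induction m with
    | zero => exact ⟨hL 0, rfl⟩
    | succ m ih =>
      rw [hs]
      by_cases hlt : (s m).2 + 1 < L (s m).1
      · simp only [next, if_pos hlt]
        exact ⟨hlt, by omega⟩
      · simp only [next, if_neg hlt, hp]
        exact ⟨hL _, by omega⟩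
  have hsp : ∀ n, s (p n) = (n, 0) := by
    intro n
    obtain ⟨h₁, h₂⟩ := hinv (p n)
    have h₃ : (s (p n)).1 = n := by
      rcases lt_trichotomy (s (p n)).1 n with hlt | heq | hgt
      · have := hmono.monotone (Nat.succ_le_of_lt hlt)
        rw [Nat.succ_eq_add_one, hp] at this
        omega
      · exact heq
      · have := hmono hgt
        omega
    rw [h₃] at h₂
    exact Prod.ext h₃ (by simpa using h₂)
  refine ⟨fun m => f (s m).1 (s m).2, p, hmono, hf₀ 0, fun m => ?_, fun n => ?_, fun m => ?_⟩
  · obtain ⟨h₁, -⟩ := hinv m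
    have h₂ := (hf _ _ h₁).1
    change E (f (s m).1 (s m).2) (f (s (m + 1)).1 (s (m + 1)).2)
    rw [hs]
    by_cases hlt : (s m).2 + 1 < L (s m).1
    · simpa only [next, if_pos hlt] using h₂
    · simp only [next, if_neg hlt, hf₀]
      rwa [show (s m).2 + 1 = L (s m).1 by omega, hfL] at h₂
  · simp only [hsp, hf₀]
  · obtain ⟨h₁, h₂⟩ := hinv m
    rcases Nat.eq_zero_or_pos (s m).2 with h₀ | h₀
    · exact Or.inl ⟨(s m).1, by omega⟩
    · exact Or.inr ((hf _ _ h₁).2 h₀)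

namespace ParityGameGraph

/-- Colors at most 1 cannot be the maximal recurring color of `π`, as the positions `p n` yield a
recurring color of at least 2. So the maximum is shifted by 2, which keeps its parity. -/
theorem parityCondition_iff_of_color {α β : Type} {G : ParityGameGraph α} {H : ParityGameGraph β}
    {x : ℕ → α} {π : ℕ → β} {p : ℕ → ℕ} (hp : StrictMono p)
    (hc : ∀ n, H.color (π (p n)) = G.color (x n) + 2)
    (haux : ∀ m, (∃ n, m = p n) ∨ H.color (π m) ≤ 1) {d : ℕ} (hd : ∀ n, G.color (x n) ≤ d) :
    H.ParityCondition π ↔ G.ParityCondition x := by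
  obtain ⟨m, hm⟩ : ∃ m, IsGreatest {c | ∃ᶠ n in Filter.atTop, G.color (x n) = c} m := by
    refine ⟨_, Nat.sSup_mem ?_ ?_, fun c hc => le_csSup ?_ hc⟩
    -- If each of the colors `0, …, d` occurred only finitely often, then from some point on no
    -- color would be left.
    · by_contra hempty
      have hev : ∀ c : Fin (d + 1), ∀ᶠ n in Filter.atTop, G.color (x n) ≠ c := by
        intro c
        by_contra hfreq
        exact hempty ⟨c, Filter.not_eventually.1 hfreq |>.mono fun _ h => not_not.1 h⟩
      obtain ⟨n, hn⟩ := (Filter.eventually_all.2 hev).exists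
      exact hn ⟨G.color (x n), Nat.lt_succ_of_le (hd n)⟩ rfl
    all_goals
      refine ⟨d, fun c hc => ?_⟩
      obtain ⟨n, rfl⟩ := hc.exists
      exact hd n
  have hm' : IsGreatest {c | ∃ᶠ n in Filter.atTop, H.color (π n) = c} (m + 2) := by
    refine ⟨hp.tendsto_atTop.frequently (hm.1.mono fun n hn => by rw [hc, hn]), fun c hcf => ?_⟩
    rcases Nat.lt_or_ge 1 c with hlt | hle
    · have : c - 2 ≤ m := by
        refine hm.2 (Filter.frequently_atTop.2 fun N => ?_)
        obtain ⟨k, hk, hkc⟩ := Filter.frequently_atTop.1 hcf (p N)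
        rcases haux k with ⟨n, rfl⟩ | h1
        · refine ⟨n, hp.le_iff_le.1 hk, ?_⟩
          rw [hc] at hkc
          omega
        · omega
      omega
    · omega
  constructor
  · rintro ⟨k, hk, heven⟩
    obtain rfl := hk.unique hm'
    exact ⟨m, hm, by simpa [Nat.even_add] using heven⟩
  · rintro ⟨k, hk, heven⟩
    obtain rfl := hk.unique hm
    exact ⟨_, hm', by simpa [Nat.even_add] using heven⟩

theorem wonBy_iff_of_color {α β : Type} {G : ParityGameGraph α} {H : ParityGameGraph β}
    {x : ℕ → α} {π : ℕ → β} {p : ℕ → ℕ} (hp : StrictMono p)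
    (hc : ∀ n, H.color (π (p n)) = G.color (x n) + 2)
    (haux : ∀ m, (∃ n, m = p n) ∨ H.color (π m) ≤ 1) {d : ℕ} (hd : ∀ n, G.color (x n) ≤ d)
    (P : Player) : H.WonBy P π ↔ G.WonBy P x := by
  cases P
  · exact not_congr (parityCondition_iff_of_color hp hc haux hd)
  · exact parityCondition_iff_of_color hp hc haux hd

end ParityGameGraph

/-! ### The edges of the pushdown game graph -/

section Rules

variable {A QI QII : Type} {R : RuleFamily (A ⊕ (QI ⊕ QII))}

@[simp]
theorem auxState_inj {P P' : Player} {s s' : AuxState R} :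
    auxState P s = auxState P' s' ↔ P = P' ∧ s = s' := by
  cases P <;> cases P' <;> simp [auxState]

@[simp]
theorem gState_ne_auxState {q : QI ⊕ QII} {P : Player} {s : AuxState R} :
    gState q ≠ auxState P s := by
  cases P <;> cases q <;> simp [auxState, gState]

@[simp]
theorem auxState_ne_gState {q : QI ⊕ QII} {P : Player} {s : AuxState R} :
    auxState P s ≠ gState q :=
  gState_ne_auxState.symm

theorem gState_injective : Function.Injective (gState : QI ⊕ QII → HState R) := by
  rintro (q | q) (q' | q') h <;> simp_all [gState]

/-! ### Inversion of the rules by source control state -/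

theorem MicroRule.of_gState {top : Option A} {q : QI ⊕ QII} {v : List A} {p : HState R}
    (h : MicroRule R ⟨top, gState q, v, p⟩) : v = top.toList ∧ ∃ i, p =
      auxState (owner q) (.readU i ((R.autU i).step (R.autU i).start (.inr q))) := by
  generalize hr : (⟨top, gState q, v, p⟩ : PushdownRule A (HState R)) = r at h
  cases h <;> simp [winState] at hr
  case choose q' i top' =>
    obtain ⟨rfl, hq, rfl, rfl⟩ := hr
    obtain rfl := gState_injective hq
    exact ⟨rfl, i, rfl⟩

theorem MicroRule.of_readU {top : Option A} {P : Player} {i : Fin R.k} {s : R.SU i} {v : List A}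
    {p : HState R} (h : MicroRule R ⟨top, auxState P (.readU i s), v, p⟩) :
    (∃ a, top = some a ∧ v = [] ∧ p = auxState P (.readU i ((R.autU i).step s (.inl a)))) ∨
    (top = none ∧ v = [] ∧ p = auxState P (.readU i s)) ∨
    (s ∈ (R.autU i).accept ∧ v = top.toList ∧
      p = auxState P.other (.readW i (R.autW i).start)) := by
  generalize hr : (⟨top, auxState P (.readU i s), v, p⟩ : PushdownRule A (HState R)) = r at h
  cases h <;> simp [winState] at hr
  all_goals
    obtain ⟨rfl, ⟨rfl, rfl, hs⟩, rfl, rfl⟩ := hr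
    obtain rfl := eq_of_heq hs
    simp_all

theorem MicroRule.of_readW {top : Option A} {P : Player} {i : Fin R.k} {s : R.SW i} {v : List A}
    {p : HState R} (h : MicroRule R ⟨top, auxState P (.readW i s), v, p⟩) :
    (∃ a, top = some a ∧ v = [] ∧ p = auxState P (.readW i ((R.autW i).step s (.inl a)))) ∨
    (top = none ∧ v = [] ∧ s ∈ (R.autW i).accept ∧ p = winState P.other) ∨
    (top = none ∧ v = [] ∧ s ∉ (R.autW i).accept ∧ p = winState P) ∨
    (s = (R.autW i).start ∧ v = top.toList ∧
      p = auxState P.other (.readV i (R.autV i).start)) := by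
  generalize hr : (⟨top, auxState P (.readW i s), v, p⟩ : PushdownRule A (HState R)) = r at h
  cases h <;> simp at hr
  case sink => simp [winState] at hr
  all_goals
    obtain ⟨rfl, ⟨rfl, rfl, hs⟩, rfl, rfl⟩ := hr
    obtain rfl := eq_of_heq hs
    simp_all

theorem MicroRule.of_readV {top : Option A} {P : Player} {i : Fin R.k} {s : R.SV i} {v : List A}
    {p : HState R} (h : MicroRule R ⟨top, auxState P (.readV i s), v, p⟩) :
    (∃ a, v = top.toList ++ [a] ∧ p = auxState P (.readV i ((R.autV i).step s (.inl a)))) ∨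
    (∃ q, (R.autV i).step s (.inr q) ∈ (R.autV i).accept ∧ v = top.toList ∧ p = gState q) := by
  generalize hr : (⟨top, auxState P (.readV i s), v, p⟩ : PushdownRule A (HState R)) = r at h
  cases h <;> simp [winState] at hr
  case pushV =>
    obtain ⟨rfl, ⟨rfl, rfl, hs⟩, rfl, rfl⟩ := hr
    obtain rfl := eq_of_heq hs
    exact Or.inl ⟨_, rfl, rfl⟩
  case leave q hq _ =>
    obtain ⟨rfl, ⟨rfl, rfl, hs⟩, rfl, rfl⟩ := hr
    obtain rfl := eq_of_heq hs
    exact Or.inr ⟨q, hq, rfl, rfl⟩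

theorem MicroRule.of_sink {top : Option A} {P : Player} {v : List A} {p : HState R}
    (h : MicroRule R ⟨top, auxState P .sink, v, p⟩) :
    v = top.toList ∧ p = auxState P .sink := by
  generalize hr : (⟨top, auxState P .sink, v, p⟩ : PushdownRule A (HState R)) = r at h
  cases h <;> simp [winState] at hr
  case sink =>
    obtain ⟨rfl, rfl, rfl, rfl⟩ := hr
    exact ⟨rfl, rfl⟩

variable {G : ParityGameGraph (List (A ⊕ (QI ⊕ QII)))}

/-- Lets the rules for a top letter and those for the bottom symbol be handled uniformly. -/
theorem exists_top (w : List A) :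
    ∃ (w₀ : List A) (top : Option A), w = w₀ ++ top.toList ∧ (top = none → w₀ = []) := by
  rcases List.eq_nil_or_concat w with rfl | ⟨w, a, rfl⟩
  · exact ⟨[], none, rfl, fun _ => rfl⟩
  · exact ⟨w, some a, by simp, by simp⟩

theorem embed_vertex (w : List A) (q : QI ⊕ QII) : embed R (vertex w q) = vertex w (gState q) := by
  simp [embed, vertex, Function.comp_def]

theorem ParityGameGraph.IsNormal.mem_ownedBy_iff (hG : G.IsNormal) {P : Player}
    {x : List (A ⊕ (QI ⊕ QII))} :
    x ∈ G.ownedBy P ↔ ∃ w q, owner q = P ∧ x = vertex w q := by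
  cases P
  · rw [ParityGameGraph.ownedBy, hG.V₁_eq]
    exact ⟨fun ⟨w, q, h⟩ => ⟨w, _, rfl, h⟩, fun ⟨w, q, h, h'⟩ => by
      cases q
      · exact ⟨w, _, h'⟩
      · simp [owner] at h⟩
  · rw [ParityGameGraph.ownedBy, hG.V₂_eq]
    exact ⟨fun ⟨w, q, h⟩ => ⟨w, _, rfl, h⟩, fun ⟨w, q, h, h'⟩ => by
      cases q
      · simp [owner] at h
      · exact ⟨w, _, h'⟩⟩

theorem ParityGameGraph.IsNormal.mem_V_iff (hG : G.IsNormal) {x : List (A ⊕ (QI ⊕ QII))} :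
    x ∈ G.V ↔ ∃ w q, x = vertex w q := by
  constructor
  · intro hx
    rcases hx with hx | hx
    · obtain ⟨w, q, -, h⟩ := (hG.mem_ownedBy_iff (P := .one)).1 hx
      exact ⟨w, q, h⟩
    · obtain ⟨w, q, -, h⟩ := (hG.mem_ownedBy_iff (P := .two)).1 hx
      exact ⟨w, q, h⟩
  · rintro ⟨w, q, rfl⟩
    exact ParityGameGraph.mem_V_of_mem_ownedBy (hG.mem_ownedBy_iff.2 ⟨w, q, rfl, rfl⟩)

theorem RuleFamily.mem_U_iff {i : Fin R.k} {u : List (A ⊕ (QI ⊕ QII))} :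
    u ∈ R.U i ↔ (R.autU i).evalFrom (R.autU i).start u.reverse ∈ (R.autU i).accept := by
  rw [← Language.reverse_mem_reverse, ← R.autU_accepts]
  rfl

theorem RuleFamily.mem_V_iff {i : Fin R.k} {u : List (A ⊕ (QI ⊕ QII))} :
    u ∈ R.V i ↔ (R.autV i).evalFrom (R.autV i).start u ∈ (R.autV i).accept := by
  rw [← R.autV_accepts]
  rfl

theorem RuleFamily.mem_W_iff {i : Fin R.k} {u : List (A ⊕ (QI ⊕ QII))} :
    u ∈ R.W i ↔ (R.autW i).evalFrom (R.autW i).start u.reverse ∈ (R.autW i).accept := by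
  rw [← Language.reverse_mem_reverse, ← R.autW_accepts]
  rfl

/-- An edge of a normal graph replaces a suffix `u q` of a vertex by a suffix `v q'`. -/
theorem RuleFamily.Represents.edge_iff (hR : R.Represents G) (hG : G.IsNormal)
    {x y : List (A ⊕ (QI ⊕ QII))} : G.E x y ↔ ∃ (i : Fin R.k) (w u v : List A) (q q' : QI ⊕ QII),
      vertex u q ∈ R.U i ∧ vertex v q' ∈ R.V i ∧ w.map Sum.inl ∈ R.W i ∧
        x = vertex (w ++ u) q ∧ y = vertex (w ++ v) q' := by
  constructor
  · intro h
    obtain ⟨hx, hy⟩ := G.edge_mem x y h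
    obtain ⟨i, u, hu, v, hv, w, hw, rfl, rfl⟩ := (hR x hx y hy).1 h
    obtain ⟨x₀, q, hx⟩ := hG.mem_V_iff.1 hx
    obtain ⟨y₀, q', hy⟩ := hG.mem_V_iff.1 hy
    have suffix : ∀ {w u : List (A ⊕ (QI ⊕ QII))} {x₀ q}, w ++ u = vertex x₀ q → u ≠ [] →
        ∃ w₀ u₀ : List A, w = w₀.map Sum.inl ∧ u = vertex u₀ q := by
      intro w u x₀ q h hu
      obtain ⟨u₁, b, rfl⟩ := (List.eq_nil_or_concat u).resolve_left hu
      rw [vertex, List.concat_eq_append, ← List.append_assoc] at h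
      obtain ⟨h₁, h₂⟩ := List.append_inj' h rfl
      obtain ⟨w₀, u₀, -, rfl, rfl⟩ := List.append_eq_map_iff.1 h₁
      exact ⟨w₀, u₀, rfl, by simp [vertex, List.singleton_inj.1 h₂]⟩
    have mem : ∀ (w₀ u₀ : List A) (q q' : QI ⊕ QII), Sum.inr q' ∉ w₀.map Sum.inl := by simp
    -- Not both are empty. If just one is, the control letter of one vertex lies in the nonempty
    -- suffix, so `w` is a word over `A`; but `w` is the other vertex and ends with a control
    -- letter.
    have hne : u ≠ [] ∧ v ≠ [] := by
      by_cases hu₀ : u = []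
      · have hv₀ : v ≠ [] := fun hv₀ => R.not_nil i ⟨hu₀ ▸ hu, hv₀ ▸ hv⟩
        obtain ⟨w₀, u₀, rfl, -⟩ := suffix hy hv₀
        refine (mem w₀ [] q q ?_).elim
        rw [hu₀, List.append_nil] at hx
        simp [hx, vertex]
      · refine ⟨hu₀, fun hv₀ => ?_⟩
        obtain ⟨w₀, u₀, rfl, -⟩ := suffix hx hu₀
        refine (mem w₀ [] q q' ?_).elim
        rw [hv₀, List.append_nil] at hy
        simp [hy, vertex]
    obtain ⟨w₀, u₀, rfl, rfl⟩ := suffix hx hne.1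
    obtain ⟨w₁, v₀, -, rfl⟩ := suffix hy hne.2
    exact ⟨i, w₀, u₀, v₀, q, q', hu, hv, hw, by simp [vertex], by simp [vertex]⟩
  · rintro ⟨i, w, u, v, q, q', hu, hv, hw, rfl, rfl⟩
    exact (hR _ (hG.mem_V_iff.2 ⟨_, _, rfl⟩) _ (hG.mem_V_iff.2 ⟨_, _, rfl⟩)).2
      ⟨i, _, hu, _, hv, _, hw, by simp [vertex], by simp [vertex]⟩

/-! ### Edges of `H` by control state -/

variable [Finite A] [Finite QI] [Finite QII]

theorem hGraph_edge_iff {w : List A} {p : HState R} {y : List (HAlphabet R)} :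
    (hGraph R G).E (vertex w p) y ↔ ∃ w₀ top v q, (⟨top, p, v, q⟩ : PushdownRule _ _) ∈ hRules R ∧
      w = w₀ ++ top.toList ∧ (top = none → w₀ = []) ∧ y = vertex (w₀ ++ v) q := by
  constructor
  · intro h
    change PushdownEdge (hRules R) _ _ at h
    generalize hx : vertex w p = x at h
    cases h with
    | letter w₀ a p' v q h =>
      obtain ⟨rfl, rfl⟩ := vertex_inj.1 hx
      exact ⟨w₀, some a, v, q, h, rfl, by simp, rfl⟩
    | bottom p' v q h =>
      obtain ⟨rfl, rfl⟩ := vertex_inj.1 hx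
      exact ⟨[], none, v, q, h, rfl, by simp, rfl⟩
  · rintro ⟨w₀, _ | a, v, q, h, rfl, h₀, rfl⟩
    · obtain rfl := h₀ rfl
      exact PushdownEdge.bottom p v q h
    · exact PushdownEdge.letter w₀ a p v q h

theorem hGraph_edge_cases {w : List A} {p : HState R} {y : List (HAlphabet R)}
    (h : (hGraph R G).E (vertex w p) y) :
    (∃ w₀ top v q, MicroRule R ⟨top, p, v, q⟩ ∧ w = w₀ ++ top.toList ∧
      (top = none → w₀ = []) ∧ y = vertex (w₀ ++ v) q) ∨
    (y = vertex w p ∧ ∃ top, (top = none → w = []) ∧ ∀ v q, ¬ MicroRule R ⟨top, p, v, q⟩) := by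
  obtain ⟨w₀, top, v, q, hr, rfl, h₀, rfl⟩ := hGraph_edge_iff.1 h
  rcases hr with hr | ⟨hr, hv, hq⟩
  · exact Or.inl ⟨w₀, top, v, q, hr, rfl, h₀, rfl⟩
  · dsimp only at hv hq hr
    subst hv hq
    refine Or.inr ⟨rfl, top, ?_, fun v q h => hr _ h ⟨rfl, rfl⟩⟩
    rintro rfl
    simpa using h₀ rfl

theorem hGraph_edge_of_keep {p q : HState R} {v : List A}
    (h : ∀ top : Option A, MicroRule R ⟨top, p, top.toList ++ v, q⟩) (w : List A) :
    (hGraph R G).E (vertex w p) (vertex (w ++ v) q) := by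
  obtain ⟨w₀, top, rfl, h₀⟩ := exists_top w
  exact hGraph_edge_iff.2 ⟨w₀, top, _, q, Or.inl (h top), rfl, h₀, by simp⟩

theorem hGraph_edge_of_pop {p q : HState R} {a : A} (h : MicroRule R ⟨some a, p, [], q⟩)
    (w : List A) : (hGraph R G).E (vertex (w ++ [a]) p) (vertex w q) :=
  hGraph_edge_iff.2 ⟨w, some a, [], q, Or.inl h, rfl, by simp, by simp⟩

theorem hGraph_edge_of_bottom {p q : HState R} (h : MicroRule R ⟨none, p, [], q⟩) :
    (hGraph R G).E (vertex [] p) (vertex [] q) :=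
  hGraph_edge_iff.2 ⟨[], none, [], q, Or.inl h, rfl, by simp, by simp⟩

/-- The index `i₀` excludes the default self-loop, which would be present if there were no triple to
choose. -/
theorem hGraph_edge_gState {w : List A} {q : QI ⊕ QII} {y : List (HAlphabet R)} (i₀ : Fin R.k)
    (h : (hGraph R G).E (vertex w (gState q)) y) : ∃ i, y = vertex w
      (auxState (owner q) (.readU i ((R.autU i).step (R.autU i).start (.inr q)))) := by
  rcases hGraph_edge_cases h with ⟨w₀, top, v, p, hr, rfl, -, rfl⟩ | ⟨-, top, -, hr⟩
  · obtain ⟨rfl, i, rfl⟩ := hr.of_gState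
    exact ⟨i, rfl⟩
  · exact (hr _ _ (.choose q i₀ top)).elim

/-- The stationary alternative stands for `bottomU` and also absorbs a default self-loop, so it need
not be decided whether one exists. -/
theorem hGraph_edge_readU {w : List A} {P : Player} {i : Fin R.k} {s : R.SU i}
    {y : List (HAlphabet R)} (h : (hGraph R G).E (vertex w (auxState P (.readU i s))) y) :
    (∃ w₀ a, w = w₀ ++ [a] ∧
      y = vertex w₀ (auxState P (.readU i ((R.autU i).step s (.inl a))))) ∨
    y = vertex w (auxState P (.readU i s)) ∨
    (s ∈ (R.autU i).accept ∧ y = vertex w (auxState P.other (.readW i (R.autW i).start))) := by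
  rcases hGraph_edge_cases h with ⟨w₀, top, v, p, hr, rfl, -, rfl⟩ | ⟨h, -⟩
  · rcases hr.of_readU with ⟨a, rfl, rfl, rfl⟩ | ⟨rfl, rfl, rfl⟩ | ⟨hs, rfl, rfl⟩
    · exact Or.inl ⟨w₀, a, rfl, by simp⟩
    · exact Or.inr (Or.inl rfl)
    · exact Or.inr (Or.inr ⟨hs, rfl⟩)
  · exact Or.inr (Or.inl h)

theorem hGraph_edge_readW {w : List A} {P : Player} {i : Fin R.k} {s : R.SW i}
    {y : List (HAlphabet R)} (h : (hGraph R G).E (vertex w (auxState P (.readW i s))) y) :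
    (∃ w₀ a, w = w₀ ++ [a] ∧
      y = vertex w₀ (auxState P (.readW i ((R.autW i).step s (.inl a))))) ∨
    (w = [] ∧ s ∈ (R.autW i).accept ∧ y = vertex [] (winState P.other)) ∨
    (w = [] ∧ s ∉ (R.autW i).accept ∧ y = vertex [] (winState P)) ∨
    (s = (R.autW i).start ∧ y = vertex w (auxState P.other (.readV i (R.autV i).start))) := by
  rcases hGraph_edge_cases h with ⟨w₀, top, v, p, hr, rfl, h₀, rfl⟩ | ⟨-, top, -, hr⟩
  · rcases hr.of_readW with ⟨a, rfl, rfl, rfl⟩ | ⟨rfl, rfl, hs, rfl⟩ | ⟨rfl, rfl, hs, rfl⟩ |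
      ⟨hs, rfl, rfl⟩
    · exact Or.inl ⟨w₀, a, rfl, by simp⟩
    · exact Or.inr (Or.inl (by simp [h₀ rfl, hs]))
    · exact Or.inr (Or.inr (Or.inl (by simp [h₀ rfl, hs])))
    · exact Or.inr (Or.inr (Or.inr ⟨hs, rfl⟩))
  · rcases top with _ | a
    · by_cases hs : s ∈ (R.autW i).accept
      · exact (hr _ _ (.acceptW P i s hs)).elim
      · exact (hr _ _ (.rejectW P i s hs)).elim
    · exact (hr _ _ (.popW P i s a)).elim

theorem hGraph_edge_readV {w : List A} {P : Player} {i : Fin R.k} {s : R.SV i}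
    {y : List (HAlphabet R)} (h : (hGraph R G).E (vertex w (auxState P (.readV i s))) y) :
    (∃ a, y = vertex (w ++ [a]) (auxState P (.readV i ((R.autV i).step s (.inl a))))) ∨
    y = vertex w (auxState P (.readV i s)) ∨
    (∃ q, (R.autV i).step s (.inr q) ∈ (R.autV i).accept ∧ y = vertex w (gState q)) := by
  rcases hGraph_edge_cases h with ⟨w₀, top, v, p, hr, rfl, -, rfl⟩ | ⟨h, -⟩
  · rcases hr.of_readV with ⟨a, rfl, rfl⟩ | ⟨q, hs, rfl, rfl⟩
    · exact Or.inl ⟨a, by simp⟩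
    · exact Or.inr (Or.inr ⟨q, hs, rfl⟩)
  · exact Or.inr (Or.inl h)

theorem hGraph_edge_sink {w : List A} {P : Player} {y : List (HAlphabet R)}
    (h : (hGraph R G).E (vertex w (auxState P .sink)) y) : y = vertex w (auxState P .sink) := by
  rcases hGraph_edge_cases h with ⟨w₀, top, v, p, hr, rfl, -, rfl⟩ | ⟨h, -⟩
  · obtain ⟨rfl, rfl⟩ := hr.of_sink
    rfl
  · exact h

theorem vertex_auxState_mem_ownedBy {w : List A} {P : Player} {s : AuxState R} :
    vertex w (auxState P s) ∈ (hGraph R G).ownedBy P := by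
  cases P
  · exact ⟨w, _, rfl⟩
  · exact ⟨w, _, rfl⟩

theorem vertex_gState_mem_ownedBy {w : List A} {q : QI ⊕ QII} :
    vertex w (gState q) ∈ (hGraph R G).ownedBy (owner q) := by
  cases q
  · exact ⟨w, _, rfl⟩
  · exact ⟨w, _, rfl⟩

theorem exists_eq_vertex {x : List (HAlphabet R)} (hx : x ∈ (hGraph R G).V) :
    ∃ w p, x = vertex w p := by
  rcases hx with ⟨w, p, rfl⟩ | ⟨w, p, rfl⟩ <;> exact ⟨w, _, rfl⟩

theorem hGraph_color_auxState {w : List A} {P : Player} {s : AuxState R} :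
    (hGraph R G).color (vertex w (auxState P s)) = P.losingColor := by
  refine (wordColor_vertex _ _ _).trans ?_
  cases P <;> rfl

theorem hGraph_color_gState {w : List A} {q : QI ⊕ QII} :
    (hGraph R G).color (vertex w (gState q)) = G.color (vertex [] q) + 2 := by
  refine (wordColor_vertex _ _ _).trans ?_
  cases q <;> rfl

end Rules

/-! ### Simulation of moves in the pushdown game graph -/

section Simulation

variable {A QI QII : Type} (R : RuleFamily (A ⊕ (QI ⊕ QII)))

/-- The steps of `H` between two vertices of `G`: player `P` moves according to `T`, and the
opponent does not check the stack content. -/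
def MicroStep (P : Player) (T : List (HAlphabet R) → List (HAlphabet R) → Prop)
    (z z' : List (HAlphabet R)) : Prop :=
  (∃ s : AuxState R, ∃ w, z = w ++ [Sum.inr (auxState P s)] ∧ T z z') ∨
    ∃ i : Fin R.k, ∃ w, z = w ++ [Sum.inr (auxState P.other (.readW i (R.autW i).start))] ∧
      z' = w ++ [Sum.inr (auxState P (.readV i (R.autV i).start))]

/-- If player `P` moves according to `T` and the opponent does not check the stack content, then `z'` is
reached from the vertex `z` of player `P`. -/
def MacroStep (P : Player) (T : List (HAlphabet R) → List (HAlphabet R) → Prop)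
    (z z' : List (HAlphabet R)) : Prop :=
  ∃ v, T z v ∧ Relation.ReflTransGen (MicroStep R P T) v z'

/-- The vertices with auxiliary control states. -/
def IsAuxVertex (z : List (HAlphabet R)) : Prop := ∃ w P s, z = vertex w (auxState P s)

variable {R}

/-- `MicroStep` admits any word over the alphabet of `H` in front of the control state, which keeps
its formula simple. On vertices this makes no difference. -/
theorem eq_vertex_of_eq_append {w : List (HAlphabet R)} {w' : List A} {p p' : HState R}
    (h : vertex w' p' = w ++ [Sum.inr p]) : w = w'.map Sum.inl ∧ p = p' := by
  obtain ⟨h₁, h₂⟩ := List.append_inj' h rfl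
  exact ⟨h₁.symm, by simpa using h₂.symm⟩

/-- A path of micro-steps thus ends at the first vertex of `G` that it meets. -/
theorem vertex_gState_not_microStep {P : Player}
    {T : List (HAlphabet R) → List (HAlphabet R) → Prop} {w : List A} {q : QI ⊕ QII}
    {z : List (HAlphabet R)} : ¬ MicroStep R P T (vertex w (gState q)) z := by
  rintro (⟨s, w', h, -⟩ | ⟨i, w', h, -⟩) <;> simpa using (eq_vertex_of_eq_append h).2

variable [Finite A] [Finite QI] [Finite QII] {G : ParityGameGraph (List (A ⊕ (QI ⊕ QII)))}
  {P : Player} {z₀ : List (HAlphabet R)} {τ : List (HAlphabet R) → List (HAlphabet R)}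

section Strategy

variable (hτ : (hGraph R G).IsWinningStrategy P z₀ τ)
include hτ

/-- This sink belongs to `P`, has the losing color of `P`, and cannot be left. -/
theorem not_reachable_losing_sink {w : List A} :
    ¬ (hGraph R G).CompatiblyReachable P τ z₀ (vertex w (auxState P .sink)) := by
  intro h
  have hK : ∀ v ∈ ({vertex w (auxState P .sink)} : Set (List (HAlphabet R))),
      v ∈ (hGraph R G).ownedBy P ∧ (hGraph R G).color v = P.losingColor := by
    rintro _ rfl
    exact ⟨vertex_auxState_mem_ownedBy, hGraph_color_auxState⟩
  obtain ⟨v, -, -, h⟩ := hτ.exists_leave (goal := fun _ => False) hK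
    (by rintro _ rfl h; exact Or.inl (hGraph_edge_sink h)) rfl h
  exact h

/-- The opponent may carry out the check to its end; a rejection would lead to the sink in which `P`
loses. -/
theorem accept_of_opponent_check {i : Fin R.k} {w : List A} {s : R.SW i}
    (h : (hGraph R G).CompatiblyReachable P τ z₀ (vertex w (auxState P.other (.readW i s)))) :
    (R.autW i).evalFrom s (w.map Sum.inl).reverse ∈ (R.autW i).accept := by
  induction w using List.reverseRecOn generalizing s with
  | nil =>
    by_contra hs
    refine not_reachable_losing_sink hτ (w := []) (h.tail
      (ParityGameGraph.compatibleEdge_of_other vertex_auxState_mem_ownedBy ?_))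
    simpa [winState] using hGraph_edge_of_bottom (G := G) (.rejectW P.other i s hs)
  | append_singleton w a ih =>
    simpa using ih (h.tail (ParityGameGraph.compatibleEdge_of_other vertex_auxState_mem_ownedBy
      (hGraph_edge_of_pop (.popW P.other i s a) w)))

/-- Away from the initial state, which is never reentered, `P` has to finish the check, and
acceptance would make the opponent win. -/
theorem not_accept_of_own_check {i : Fin R.k} {w : List A} {s : R.SW i}
    (h : (hGraph R G).CompatiblyReachable P τ z₀ (vertex w (auxState P (.readW i s))))
    (hs : s ≠ (R.autW i).start) :
    (R.autW i).evalFrom s (w.map Sum.inl).reverse ∉ (R.autW i).accept := by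
  induction w using List.reverseRecOn generalizing s with
  | nil =>
    intro hacc
    have h' := h.strategy hτ.1 vertex_auxState_mem_ownedBy
    rcases hGraph_edge_readW (h.edge_strategy hτ.1 vertex_auxState_mem_ownedBy) with
      ⟨w₀, a, hw, -⟩ | ⟨-, -, heq⟩ | ⟨-, hs', -⟩ | ⟨hs', -⟩
    · simp at hw
    · rw [heq] at h'
      exact not_reachable_losing_sink hτ (w := []) (by simpa [winState] using h')
    · exact hs' hacc
    · exact hs hs'
  | append_singleton w a ih =>
    have h' := h.strategy hτ.1 vertex_auxState_mem_ownedBy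
    rcases hGraph_edge_readW (h.edge_strategy hτ.1 vertex_auxState_mem_ownedBy) with
      ⟨w₀, a', hw, heq⟩ | ⟨hw, -⟩ | ⟨hw, -⟩ | ⟨hs', -⟩
    · obtain ⟨rfl, ha⟩ := List.append_inj' hw rfl
      obtain rfl := List.singleton_inj.1 ha
      rw [heq] at h'
      simpa using ih h' (R.start_not_reentered i s _)
    · simp at hw
    · simp at hw
    · exact (hs hs').elim

/-- If the stack content is as it should be, then player `P` lets the opponent proceed. -/
theorem strategy_eq_proceed {i : Fin R.k} {w : List A}
    (h : (hGraph R G).CompatiblyReachable P τ z₀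
      (vertex w (auxState P (.readW i (R.autW i).start))))
    (hw : w.map Sum.inl ∈ R.W i) : τ (vertex w (auxState P (.readW i (R.autW i).start))) =
      vertex w (auxState P.other (.readV i (R.autV i).start)) := by
  rw [RuleFamily.mem_W_iff] at hw
  have h' := h.strategy hτ.1 vertex_auxState_mem_ownedBy
  rcases hGraph_edge_readW (h.edge_strategy hτ.1 vertex_auxState_mem_ownedBy) with
    ⟨w₀, a, rfl, heq⟩ | ⟨rfl, -, heq⟩ | ⟨rfl, hs', -⟩ | ⟨-, heq⟩
  · rw [heq] at h'
    exact (not_accept_of_own_check hτ h' (R.start_not_reentered i _ _) (by simpa using hw)).elim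
  · rw [heq] at h'
    exact (not_reachable_losing_sink hτ (w := []) (by simpa [winState] using h')).elim
  · exact (hs' hw).elim
  · exact heq

variable {T : List (HAlphabet R) → List (HAlphabet R) → Prop}
  (hT : ∀ x ∈ (hGraph R G).ownedBy P, (hGraph R G).ReachableFrom z₀ x → ∀ y, T x y ↔ y = τ x)
include hT

/-- Reachability is assumed because `T` is known to agree with `τ` only at reachable vertices of
`P`. -/
theorem MicroStep.edge {z z' : List (HAlphabet R)}
    (hz : (hGraph R G).CompatiblyReachable P τ z₀ z) (hV : z ∈ (hGraph R G).V)
    (h : MicroStep R P T z z') :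
    IsAuxVertex R z ∧ (hGraph R G).CompatibleEdge P τ z z' := by
  obtain ⟨w, p, rfl⟩ := exists_eq_vertex hV
  rcases h with ⟨s, w', h, hz'⟩ | ⟨i, w', h, rfl⟩
  · obtain ⟨-, rfl⟩ := eq_vertex_of_eq_append h
    obtain rfl := (hT _ vertex_auxState_mem_ownedBy hz.reachable _).1 hz'
    exact ⟨⟨w, P, s, rfl⟩, hz.edge_strategy hτ.1 vertex_auxState_mem_ownedBy, fun _ => rfl⟩
  · obtain ⟨rfl, rfl⟩ := eq_vertex_of_eq_append h
    refine ⟨⟨w, _, _, rfl⟩, ParityGameGraph.compatibleEdge_of_other vertex_auxState_mem_ownedBy ?_⟩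
    simpa [vertex] using hGraph_edge_of_keep (G := G) (v := [])
      (fun top => by simpa using MicroRule.proceed P.other i top) w

omit hτ in
theorem MicroStep.unique {z z' z'' : List (HAlphabet R)}
    (hz : (hGraph R G).CompatiblyReachable P τ z₀ z) (hV : z ∈ (hGraph R G).V)
    (h : MicroStep R P T z z') (h' : MicroStep R P T z z'') : z' = z'' := by
  obtain ⟨w, p, rfl⟩ := exists_eq_vertex hV
  rcases h with ⟨s, w', h, hz'⟩ | ⟨i, w', h, rfl⟩ <;> obtain ⟨rfl, rfl⟩ := eq_vertex_of_eq_append h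
  · have hT' := hT _ vertex_auxState_mem_ownedBy hz.reachable
    rcases h' with ⟨s', w'', h', hz''⟩ | ⟨i', w'', h', rfl⟩
    · rw [(hT' _).1 hz', (hT' _).1 hz'']
    · exact (P.other_ne (auxState_inj.1 (eq_vertex_of_eq_append h').2).1).elim
  · rcases h' with ⟨s', w'', h', hz''⟩ | ⟨i', w'', h', rfl⟩
    · exact (P.other_ne (auxState_inj.1 (eq_vertex_of_eq_append h').2).1.symm).elim
    · obtain ⟨rfl, heq⟩ := eq_vertex_of_eq_append h'
      have hi := (auxState_inj.1 heq).2
      injection hi with hi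
      subst hi
      rfl

theorem reflTransGen_edge_of_microStep {v z : List (HAlphabet R)}
    (hv : (hGraph R G).CompatiblyReachable P τ z₀ v) (hV : v ∈ (hGraph R G).V)
    (h : Relation.ReflTransGen (MicroStep R P T) v z) : Relation.ReflTransGen
      (fun a b => IsAuxVertex R a ∧ (hGraph R G).CompatibleEdge P τ a b) v z := by
  induction h using Relation.ReflTransGen.head_induction_on with
  | refl => exact .refl
  | head hab _ ih =>
    have hab' := hab.edge hτ hT hv hV
    exact .head hab' (ih (hv.tail hab'.2) ((hGraph R G).edge_mem _ _ hab'.2.1).2)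

/-- Micro-steps are deterministic and stop at vertices of `G`, so two such paths from `v` coincide.
-/
theorem reflTransGen_microStep_unique {v : List (HAlphabet R)} {w w' : List A} {q q' : QI ⊕ QII}
    (hv : (hGraph R G).CompatiblyReachable P τ z₀ v) (hV : v ∈ (hGraph R G).V)
    (h : Relation.ReflTransGen (MicroStep R P T) v (vertex w (gState q)))
    (h' : Relation.ReflTransGen (MicroStep R P T) v (vertex w' (gState q'))) :
    vertex w (gState q : HState R) = vertex w' (gState q') := by
  induction h using Relation.ReflTransGen.head_induction_on with
  | refl =>
    rcases h'.cases_head with h' | ⟨c, h', -⟩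
    · exact h'
    · exact (vertex_gState_not_microStep h').elim
  | head hab _ ih =>
    have hab' := hab.edge hτ hT hv hV
    rcases h'.cases_head with rfl | ⟨c, hac, hc⟩
    · exact (vertex_gState_not_microStep hab).elim
    · obtain rfl := hab.unique hT hv hV hac
      exact ih (hv.tail hab'.2) ((hGraph R G).edge_mem _ _ hab'.2.1).2 hc

theorem MacroStep.unique {w w₁ w₂ : List A} {q q₁ q₂ : QI ⊕ QII} (hq : owner q = P)
    (hz : (hGraph R G).CompatiblyReachable P τ z₀ (vertex w (gState q)))
    (h₁ : MacroStep R P T (vertex w (gState q)) (vertex w₁ (gState q₁)))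
    (h₂ : MacroStep R P T (vertex w (gState q)) (vertex w₂ (gState q₂))) :
    w₁ = w₂ ∧ q₁ = q₂ := by
  have hown : vertex w (gState q) ∈ (hGraph R G).ownedBy P := hq ▸ vertex_gState_mem_ownedBy
  have hT' := hT _ hown hz.reachable
  obtain ⟨v₁, hv₁, h₁⟩ := h₁
  obtain ⟨v₂, hv₂, h₂⟩ := h₂
  obtain rfl := (hT' _).1 hv₁
  obtain rfl := (hT' _).1 hv₂
  obtain ⟨hw, hq⟩ := vertex_inj.1 (reflTransGen_microStep_unique hτ hT (hz.strategy hτ.1 hown)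
    ((hGraph R G).edge_mem _ _ (hz.edge_strategy hτ.1 hown)).2 h₁ h₂)
  exact ⟨hw, gState_injective hq⟩

theorem MacroStep.path {w : List A} {q : QI ⊕ QII} {z : List (HAlphabet R)} (hq : owner q = P)
    (hz : (hGraph R G).CompatiblyReachable P τ z₀ (vertex w (gState q)))
    (h : MacroStep R P T (vertex w (gState q)) z) :
    ∃ v, (hGraph R G).CompatibleEdge P τ (vertex w (gState q)) v ∧ Relation.ReflTransGen
      (fun a b => IsAuxVertex R a ∧ (hGraph R G).CompatibleEdge P τ a b) v z := by
  have hown : vertex w (gState q) ∈ (hGraph R G).ownedBy P := hq ▸ vertex_gState_mem_ownedBy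
  obtain ⟨v, hv, h⟩ := h
  obtain rfl := (hT _ hown hz.reachable _).1 hv
  have hE := hz.edge_strategy hτ.1 hown
  exact ⟨_, ⟨hE, fun _ => rfl⟩, reflTransGen_edge_of_microStep hτ hT (hz.strategy hτ.1 hown)
    ((hGraph R G).edge_mem _ _ hE).2 h⟩

theorem exists_leave_microStep {K : Set (List (HAlphabet R))} {goal : List (HAlphabet R) → Prop}
    (hK : ∀ v ∈ K, ∃ w s, v = vertex w (auxState P s))
    (hstep : ∀ v ∈ K, (hGraph R G).E v (τ v) → τ v ∈ K ∨ goal (τ v)) {v : List (HAlphabet R)}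
    (hv : v ∈ K) (hr : (hGraph R G).CompatiblyReachable P τ z₀ v) :
    ∃ v', Relation.ReflTransGen (MicroStep R P T) v v' ∧ goal v' ∧
      (hGraph R G).CompatiblyReachable P τ z₀ v' := by
  have hK' : ∀ v ∈ K, v ∈ (hGraph R G).ownedBy P ∧ (hGraph R G).color v = P.losingColor := by
    intro v hv
    obtain ⟨w, s, rfl⟩ := hK v hv
    exact ⟨vertex_auxState_mem_ownedBy, hGraph_color_auxState⟩
  have step : ∀ a ∈ K, (hGraph R G).CompatiblyReachable P τ z₀ a → MicroStep R P T a (τ a) := by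
    intro a ha har
    obtain ⟨w, s, rfl⟩ := hK a ha
    exact Or.inl ⟨s, _, rfl, (hT _ (hK' _ ha).1 har.reachable _).2 rfl⟩
  obtain ⟨v', hpath, hv', hgoal⟩ := hτ.exists_leave hK' hstep hv hr
  have key : Relation.ReflTransGen (MicroStep R P T) v v' ∧
      (hGraph R G).CompatiblyReachable P τ z₀ v' := by
    clear hv' hgoal
    induction hpath with
    | refl => exact ⟨.refl, hr⟩
    | tail _ hbc ih =>
      obtain ⟨hb, rfl⟩ := hbc
      exact ⟨ih.1.tail (step _ hb ih.2), ih.2.strategy hτ.1 (hK' _ hb).1⟩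
  exact ⟨_, key.1.tail (step _ hv' key.2), hgoal, key.2.strategy hτ.1 (hK' _ hv').1⟩

/-- The strategy of player `P` leads from a vertex of this player to a successor of this vertex
in `G`. -/
theorem exists_macroStep (hG : G.IsNormal) (hR : R.Represents G) {w : List A} {q : QI ⊕ QII}
    (hq : owner q = P) (hz : (hGraph R G).CompatiblyReachable P τ z₀ (vertex w (gState q))) :
    ∃ w' q', G.E (vertex w q) (vertex w' q') ∧
      MacroStep R P T (vertex w (gState q)) (vertex w' (gState q')) := by
  have hown : vertex w (gState q) ∈ (hGraph R G).ownedBy P := hq ▸ vertex_gState_mem_ownedBy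
  obtain ⟨i₀⟩ : Nonempty (Fin R.k) := by
    obtain ⟨y, hy⟩ := G.exists_edge (vertex w q) (hG.mem_V_iff.2 ⟨w, q, rfl⟩)
    obtain ⟨i, -⟩ := (hR.edge_iff hG).1 hy
    exact ⟨i⟩
  obtain ⟨i, hi⟩ := hGraph_edge_gState i₀ (hz.edge_strategy hτ.1 hown)
  have hz₁ := hz.strategy hτ.1 hown
  rw [hi, hq] at hz₁
  -- Popping phase: the old stack is the current one followed by `u`, and `autU i` has read `q` and
  -- then `u` from its top. It ends with the turn of the opponent.
  obtain ⟨_, hpath₁, ⟨w, u, rfl, hu, rfl⟩, hz₂⟩ := exists_leave_microStep hτ hT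
    (K := {z | ∃ w' u, w = w' ++ u ∧ z = vertex w' (auxState P (.readU i
      ((R.autU i).evalFrom (R.autU i).start (vertex u q).reverse)))})
    (goal := fun z => ∃ w' u, w = w' ++ u ∧ vertex u q ∈ R.U i ∧
      z = vertex w' (auxState P.other (.readW i (R.autW i).start)))
    (by rintro _ ⟨w', u, -, rfl⟩; exact ⟨_, _, rfl⟩)
    (by
      rintro _ ⟨w', u, rfl, rfl⟩ h
      rcases hGraph_edge_readU h with ⟨w₀, a, rfl, heq⟩ | heq | ⟨hacc, heq⟩
      · exact Or.inl ⟨w₀, a :: u, by simp, by rw [heq]; simp [vertex]⟩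
      · exact Or.inl ⟨w', u, rfl, heq⟩
      · exact Or.inr ⟨w', u, rfl, R.mem_U_iff.2 hacc, heq⟩)
    ⟨w, [], by simp, rfl⟩ hz₁
  -- No check takes place on this path, but the opponent could start one here.
  have hw := R.mem_W_iff.2 (accept_of_opponent_check hτ hz₂)
  have hproceed : MicroStep R P T (vertex w (auxState P.other (.readW i (R.autW i).start)))
      (vertex w (auxState P (.readV i (R.autV i).start))) := Or.inr ⟨i, _, rfl, rfl⟩
  have hz₃ := hz₂.tail (hproceed.edge hτ hT hz₂
    (ParityGameGraph.mem_V_of_mem_ownedBy vertex_auxState_mem_ownedBy)).2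
  -- Pushing phase: `v` has been pushed and read by `autV i`, until `P` enters a vertex of `G`.
  obtain ⟨_, hpath₂, ⟨v, q', hv, rfl⟩, -⟩ := exists_leave_microStep hτ hT
    (K := {z | ∃ v, z = vertex (w ++ v) (auxState P (.readV i
      ((R.autV i).evalFrom (R.autV i).start (v.map Sum.inl))))})
    (goal := fun z => ∃ v q', vertex v q' ∈ R.V i ∧ z = vertex (w ++ v) (gState q'))
    (by rintro _ ⟨v, rfl⟩; exact ⟨_, _, rfl⟩)
    (by
      rintro _ ⟨v, rfl⟩ h
      rcases hGraph_edge_readV h with ⟨a, heq⟩ | heq | ⟨q', hacc, heq⟩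
      · exact Or.inl ⟨v ++ [a], by rw [heq]; simp⟩
      · exact Or.inl ⟨v, heq⟩
      · exact Or.inr ⟨v, q', R.mem_V_iff.2 (by simpa [vertex] using hacc), heq⟩)
    ⟨[], by simp⟩ hz₃
  refine ⟨w ++ v, q', (hR.edge_iff hG).2 ⟨i, w, u, v, q, q', hu, hv, hw, rfl, rfl⟩, _,
    (hT _ hown hz.reachable _).2 rfl, ?_⟩
  rw [hi, hq]
  exact (hpath₁.tail hproceed).trans hpath₂

omit hT in
/-- Each move of the opponent in `G` can be simulated in `H`. -/
theorem exists_path_of_opponent_move (hG : G.IsNormal) (hR : R.Represents G) {w w' : List A}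
    {q q' : QI ⊕ QII} (hq : owner q = P.other)
    (hz : (hGraph R G).CompatiblyReachable P τ z₀ (vertex w (gState q)))
    (h : G.E (vertex w q) (vertex w' q')) :
    ∃ v, (hGraph R G).CompatibleEdge P τ (vertex w (gState q)) v ∧ Relation.ReflTransGen
      (fun a b => IsAuxVertex R a ∧ (hGraph R G).CompatibleEdge P τ a b) v
      (vertex w' (gState q')) := by
  obtain ⟨i, w, u, v, q₁, q₁', hu, hv, hw, h₁, h₂⟩ := (hR.edge_iff hG).1 h
  obtain ⟨rfl, rfl⟩ := vertex_inj.1 h₁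
  obtain ⟨rfl, rfl⟩ := vertex_inj.1 h₂
  have move : ∀ {w s y}, (hGraph R G).E (vertex w (auxState P.other s)) y →
      IsAuxVertex R (vertex w (auxState P.other s)) ∧
        (hGraph R G).CompatibleEdge P τ (vertex w (auxState P.other s)) y := fun h =>
    ⟨⟨_, _, _, rfl⟩, ParityGameGraph.compatibleEdge_of_other vertex_auxState_mem_ownedBy h⟩
  have hE₁ : (hGraph R G).CompatibleEdge P τ (vertex (w ++ u) (gState q)) (vertex (w ++ u)
      (auxState P.other (.readU i ((R.autU i).step (R.autU i).start (.inr q))))) := by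
    refine ParityGameGraph.compatibleEdge_of_other (hq ▸ vertex_gState_mem_ownedBy) ?_
    rw [← hq]
    simpa using hGraph_edge_of_keep (G := G) (v := [])
      (fun top => by simpa using MicroRule.choose q i top) (w ++ u)
  have hpop : ∀ (u : List A) (s : R.SU i), Relation.ReflTransGen
      (fun a b => IsAuxVertex R a ∧ (hGraph R G).CompatibleEdge P τ a b)
      (vertex (w ++ u) (auxState P.other (.readU i s)))
      (vertex w (auxState P.other (.readU i
        ((R.autU i).evalFrom s (u.map Sum.inl).reverse)))) := by
    intro u
    induction u using List.reverseRecOn with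
    | nil => intro s; simpa using Relation.ReflTransGen.refl
    | append_singleton u a ih =>
      intro s
      refine .head (move ?_) (by simpa using ih ((R.autU i).step s (.inl a)))
      rw [← List.append_assoc]
      exact hGraph_edge_of_pop (.popU P.other i s a) _
  have hturn := move (hGraph_edge_of_keep (G := G) (v := []) (fun top => by
    simpa using MicroRule.turn P.other i _ (R.mem_U_iff.1 hu) top) w)
  rw [List.append_nil] at hturn
  have hpath₁ := (hpop u _).tail (by simpa [vertex] using hturn)
  have hz₁ : (hGraph R G).CompatiblyReachable P τ z₀ _ :=
    (hz.tail hE₁).trans (Relation.ReflTransGen.mono (fun _ _ h => h.2) _ _ hpath₁)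
  -- The only move of `P` on this path: since the claim of the opponent is true, `τ` does not check
  -- it.
  have hproceed := strategy_eq_proceed hτ hz₁ hw
  have hpath₂ := hpath₁.tail (c := vertex w (auxState P.other (.readV i (R.autV i).start)))
    ⟨⟨_, _, _, rfl⟩, hproceed ▸ hz₁.edge_strategy hτ.1 vertex_auxState_mem_ownedBy,
      fun _ => hproceed.symm⟩
  have hpush : ∀ v : List A, Relation.ReflTransGen
      (fun a b => IsAuxVertex R a ∧ (hGraph R G).CompatibleEdge P τ a b)
      (vertex w (auxState P.other (.readV i (R.autV i).start)))
      (vertex (w ++ v) (auxState P.other (.readV i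
        ((R.autV i).evalFrom (R.autV i).start (v.map Sum.inl))))) := by
    intro v
    induction v using List.reverseRecOn with
    | nil => simpa using Relation.ReflTransGen.refl
    | append_singleton v a ih =>
      refine ih.tail (move ?_)
      rw [← List.append_assoc]
      simpa using hGraph_edge_of_keep (G := G) (MicroRule.pushV P.other i _ a) (w ++ v)
  have hleave := move (hGraph_edge_of_keep (G := G) (v := []) (fun top => by
    simpa using MicroRule.leave P.other i
      ((R.autV i).evalFrom (R.autV i).start (v.map Sum.inl)) q'
      (by simpa [vertex] using R.mem_V_iff.1 hv) top) (w ++ v))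
  rw [List.append_nil] at hleave
  exact ⟨_, hE₁, (hpath₂.trans (hpush v)).tail hleave⟩

end Strategy

end Simulation

/-! ### Transfer of definable winning strategies -/

section Definability

variable {A QI QII : Type} {R : RuleFamily (A ⊕ (QI ⊕ QII))}

theorem MSODef₂.macroStep {T : List (HAlphabet R) → List (HAlphabet R) → Prop} (hT : MSODef₂ T)
    (P : Player) : MSODef₂ (MacroStep R P T) := by
  have hmicro : MSODef₂ (MicroStep R P T) := by
    refine MSODef.def₂ (MSODef.or (MSODef.exFinite fun s => ?_) (MSODef.exFinite fun i => ?_))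
    · exact MSODef.exNode (R := fun ρ _ w => ρ 0 = w ++ [Sum.inr (auxState P s)] ∧ T (ρ 0) (ρ 1))
        (((MSODef₂.append _).at 0 1).and (hT.at 1 2))
    · exact MSODef.exNode (R := fun ρ _ w =>
        ρ 0 = w ++ [Sum.inr (auxState P.other (.readW i (R.autW i).start))] ∧
          ρ 1 = w ++ [Sum.inr (auxState P (.readV i (R.autV i).start))])
        (((MSODef₂.append _).at 0 1).and ((MSODef₂.append _).at 0 2))
  exact MSODef.def₂ (MSODef.exNode
    (R := fun ρ _ v => T (ρ 0) v ∧ Relation.ReflTransGen (MicroStep R P T) v (ρ 1))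
    ((hT.at 1 0).and (hmicro.reflTransGen.at 0 2)))

variable [Finite A] [Finite QI] [Finite QII] {G : ParityGameGraph (List (A ⊕ (QI ⊕ QII)))}

/-- The edge relation of `G` has a definable choice function. -/
theorem exists_definable_choice (hE : MSODef₂ G.E) (hG : G.IsNormal) (hR : R.Represents G) :
    ∃ D : List (A ⊕ (QI ⊕ QII)) → List (A ⊕ (QI ⊕ QII)) → Prop, MSODef₂ D ∧
      ∀ x ∈ G.V, ∃ y, G.E x y ∧ ∀ y', D x y' ↔ y' = y := by
  have hv : ∀ i : Fin R.k, ∃ v, (∃ v₀ q, vertex v₀ q ∈ R.V i) →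
      ∃ v₀ q, v = vertex v₀ q ∧ vertex v₀ q ∈ R.V i := by
    intro i
    by_cases h : ∃ v₀ q, vertex v₀ q ∈ R.V i
    · obtain ⟨v₀, q, h⟩ := h
      exact ⟨_, fun _ => ⟨v₀, q, rfl, h⟩⟩
    -- This default value is harmless, as the candidates below are required to give edges of `G`.
    · exact ⟨[], fun h' => (h h').elim⟩
  choose v hv using hv
  let C : Fin R.k → List (A ⊕ (QI ⊕ QII)) → List (A ⊕ (QI ⊕ QII)) → Prop := fun i x w =>
    w <+: x ∧ G.E x (w ++ v i)
  have hC : ∀ i, MSODef₂ (C i) := by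
    intro i
    have : MSODef₂ fun x w => w <+: x ∧ ∃ y, y = w ++ v i ∧ G.E x y := by
      refine MSODef.def₂ ((MSODef₂.prefix.at 1 0).and ?_)
      refine MSODef.exNode (R := fun ρ _ y => y = ρ 1 ++ v i ∧ G.E (ρ 0) y) ?_
      exact ((MSODef₂.append (v i)).at 2 0).and (hE.at 1 0)
    exact this.congr fun x w => by simp [C]
  -- The least index with a candidate, and for it the shortest prefix. Prefixes of `x` are
  -- comparable, so the shortest one is unique.
  refine ⟨fun x y => ∃ i, (∀ j, j < i → ¬ ∃ w, C j x w) ∧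
    ∃ w, (C i x w ∧ ∀ w', C i x w' → w <+: w') ∧ y = w ++ v i, ?_, ?_⟩
  · refine MSODef.def₂ (MSODef.exFinite fun i => MSODef.and
      (MSODef.allFinite fun j => (MSODef.const _).imp (MSODef.not ?_)) ?_)
    · exact MSODef.exNode (R := fun ρ _ w => C j (ρ 0) w) ((hC j).at 1 0)
    · refine MSODef.exNode (R := fun ρ _ w => (C i (ρ 0) w ∧ ∀ w', C i (ρ 0) w' → w <+: w') ∧
        ρ 1 = w ++ v i) (MSODef.and (MSODef.and ((hC i).at 1 0) ?_) ((MSODef₂.append (v i)).at 0 2))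
      exact MSODef.allNode (R := fun ρ _ w' => C i (ρ 1) w' → ρ 0 <+: w')
        (((hC i).at 2 0).imp (MSODef₂.prefix.at 1 0))
  · intro x hx
    -- Any edge yields a candidate: its pushed part may be exchanged for the fixed word `v i` of the
    -- same language.
    have hne : {i | ∃ w, C i x w}.Nonempty := by
      obtain ⟨y, hy⟩ := G.exists_edge x hx
      obtain ⟨i, w, u, v', q, q', hu, hv', hw, rfl, -⟩ := (hR.edge_iff hG).1 hy
      obtain ⟨v₀, q₀, hvi, hv₀⟩ := hv i ⟨v', q', hv'⟩
      refine ⟨i, w.map Sum.inl, ⟨vertex u q, by simp [vertex]⟩, ?_⟩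
      exact (hR.edge_iff hG).2 ⟨i, w, u, v₀, q, q₀, hu, hv₀, hw, rfl, by simp [hvi, vertex]⟩
    obtain ⟨i, ⟨w₀, hw₀⟩, hi⟩ := wellFounded_lt.has_min _ hne
    obtain ⟨w, hw, hmin⟩ := (measure List.length).wf.has_min {w | C i x w} ⟨w₀, hw₀⟩
    have hpre : ∀ w', C i x w' → w <+: w' := fun w' hw' =>
      List.prefix_of_prefix_length_le hw.1 hw'.1 (not_lt.1 (hmin w' hw'))
    refine ⟨w ++ v i, hw.2, fun y' => ⟨?_, ?_⟩⟩
    · rintro ⟨j, hj, w', ⟨hw', hpre'⟩, rfl⟩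
      rcases lt_trichotomy i j with h | rfl | h
      · exact (hj i h ⟨w, hw⟩).elim
      · rw [(hpre w' hw').eq_of_length_le (hpre' w hw).length_le]
      · exact (hi j ⟨w', hw'⟩ h).elim
    · rintro rfl
      exact ⟨i, fun j hj hw' => hi j hw' hj, w, ⟨hw, hpre⟩, rfl⟩

/-- Relations that are definable over the alphabet of `H` are definable over the alphabet of `G`
on the vertices of `G`. -/
theorem MSODef₂.comap_embed [Nonempty A] (hG : G.IsNormal)
    {T : List (HAlphabet R) → List (HAlphabet R) → Prop} (hT : MSODef₂ T) (hV : G.V.Nonempty) :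
    ∃ T' : List (A ⊕ (QI ⊕ QII)) → List (A ⊕ (QI ⊕ QII)) → Prop, MSODef₂ T' ∧
      ∀ x ∈ G.V, ∀ y ∈ G.V, T' x y ↔ T (embed R x) (embed R y) := by
  obtain ⟨x, hx⟩ := hV
  obtain ⟨-, b, -⟩ := hG.mem_V_iff.1 hx
  obtain ⟨a⟩ := ‹Nonempty A›
  obtain ⟨e, he⟩ := Countable.exists_injective_nat (HState R)
  obtain ⟨T', hT', hiff⟩ := hT.interpret (stackCode_flatMap_injective a b he)
  -- Letters of `A` code themselves, so a vertex of `G` and the code of its embedding differ only in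
  -- the control state at the end.
  let K : List (A ⊕ (QI ⊕ QII)) → List (A ⊕ (QI ⊕ QII)) → Prop := fun x x' =>
    ∃ q : QI ⊕ QII, ∃ w, x = w ++ [Sum.inr q] ∧ x' = w ++ stackCode a b e (.inr (gState q))
  have hK : MSODef₂ K := by
    refine MSODef.def₂ (MSODef.exFinite fun q => ?_)
    exact MSODef.exNode (R := fun ρ _ w =>
      ρ 0 = w ++ [Sum.inr q] ∧ ρ 1 = w ++ stackCode a b e (.inr (gState q)))
      (((MSODef₂.append _).at 0 1).and ((MSODef₂.append _).at 0 2))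
  have hK' : ∀ x ∈ G.V, ∀ x', K x x' ↔ x' = (embed R x).flatMap (stackCode a b e) := by
    intro x hx x'
    obtain ⟨w, q, rfl⟩ := hG.mem_V_iff.1 hx
    have hcode : (embed R (vertex w q)).flatMap (stackCode a b e) =
        w.map Sum.inl ++ stackCode a b e (.inr (gState q)) := by
      rw [embed_vertex, vertex, List.flatMap_append, List.flatMap_singleton, List.flatMap_map]
      simp [stackCode, ← List.map_eq_flatMap]
    rw [hcode]
    constructor
    · rintro ⟨q', w', h, rfl⟩
      obtain ⟨rfl, hq⟩ := List.append_inj' h rfl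
      obtain rfl : q = q' := by simpa using hq
      rfl
    · rintro rfl
      exact ⟨q, _, rfl, rfl⟩
  refine ⟨fun x y => ∃ x', K x x' ∧ ∃ y', K y y' ∧ T' x' y', ?_, fun x hx y hy => ?_⟩
  · refine MSODef.def₂ (MSODef.exNode
      (R := fun ρ _ x' => K (ρ 0) x' ∧ ∃ y', K (ρ 1) y' ∧ T' x' y') ((hK.at 1 0).and ?_))
    exact MSODef.exNode (R := fun ρ _ y' => K (ρ 2) y' ∧ T' (ρ 0) y')
      ((hK.at 3 0).and (hT'.at 1 0))
  · simp only [hK' x hx, hK' y hy, exists_eq_left, hiff]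

/-- If there are no stack letters, then each strategy is definable. -/
theorem exists_definesStrategy_of_isEmpty [IsEmpty A] (hG : G.IsNormal) (P : Player)
    (u₀ : List (A ⊕ (QI ⊕ QII))) (σ : List (A ⊕ (QI ⊕ QII)) → List (A ⊕ (QI ⊕ QII))) :
    ∃ χ : MSO (A ⊕ (QI ⊕ QII)) 2 0, χ.DefinesStrategy G P u₀ σ := by
  have hdef : MSODef₂ fun x y => ∃ q : QI ⊕ QII,
      x = ([Sum.inr q] : List (A ⊕ (QI ⊕ QII))) ∧ y = σ [Sum.inr q] :=
    MSODef.def₂ (MSODef.exFinite fun q => (MSODef.eq_const 0 _).and (MSODef.eq_const 1 _))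
  obtain ⟨χ, hχ⟩ := hdef
  refine ⟨χ, fun x hx _ y => (hχ x y).trans ?_⟩
  obtain ⟨w, q, -, rfl⟩ := hG.mem_ownedBy_iff.1 hx
  obtain rfl : w = [] := Subsingleton.elim _ _
  simp [vertex]

end Definability

/-- A memoryless strategy that follows the simulation of a winning strategy in `H` is winning. -/
theorem isWinningStrategy_of_macroStep {A QI QII : Type} [Finite A] [Finite QI] [Finite QII]
    {R : RuleFamily (A ⊕ (QI ⊕ QII))} {G : ParityGameGraph (List (A ⊕ (QI ⊕ QII)))}
    (hG : G.IsNormal) (hR : R.Represents G) {P : Player} {u₀ : List (A ⊕ (QI ⊕ QII))}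
    {τ : List (HAlphabet R) → List (HAlphabet R)}
    (hτ : (hGraph R G).IsWinningStrategy P (embed R u₀) τ)
    {T : List (HAlphabet R) → List (HAlphabet R) → Prop}
    (hT : ∀ x ∈ (hGraph R G).ownedBy P, (hGraph R G).ReachableFrom (embed R u₀) x →
      ∀ y, T x y ↔ y = τ x)
    {σ : List (A ⊕ (QI ⊕ QII)) → List (A ⊕ (QI ⊕ QII))} (hσ : ∀ x ∈ G.V, G.E x (σ x))
    (hstep : ∀ x ∈ G.ownedBy P, (hGraph R G).CompatiblyReachable P τ (embed R u₀) (embed R x) →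
      MacroStep R P T (embed R x) (embed R (σ x))) :
    G.IsWinningStrategy P u₀ σ := by
  refine ⟨fun u hu _ => hσ u (ParityGameGraph.mem_V_of_mem_ownedBy hu), fun π hπ hcomp => ?_⟩
  have hV : ∀ n, π n ∈ G.V := fun n => (G.edge_mem _ _ (hπ.2 n)).1
  -- Moves of `P` are lifted by following `τ`, moves of the opponent by honest simulation. Both need
  -- a compatibly reachable start, which `hreach` supplies by induction.
  have hpath : ∀ n, (hGraph R G).CompatiblyReachable P τ (embed R u₀) (embed R (π n)) →
      ∃ v, (hGraph R G).CompatibleEdge P τ (embed R (π n)) v ∧ Relation.ReflTransGen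
        (fun a b => IsAuxVertex R a ∧ (hGraph R G).CompatibleEdge P τ a b) v
        (embed R (π (n + 1))) := by
    intro n hn
    rcases ParityGameGraph.mem_ownedBy_or_other P (hV n) with hown | hown
    · have hround := hstep _ hown hn
      rw [← hcomp n hown] at hround
      obtain ⟨w, q, hq, hx⟩ := hG.mem_ownedBy_iff.1 hown
      rw [hx, embed_vertex] at hround hn ⊢
      exact hround.path hτ hT hq hn
    · have hE := hπ.2 n
      obtain ⟨w, q, hq, hx⟩ := hG.mem_ownedBy_iff.1 hown
      obtain ⟨w', q', hx'⟩ := hG.mem_V_iff.1 (hV (n + 1))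
      rw [hx, hx'] at hE
      rw [hx, embed_vertex] at hn ⊢
      rw [hx', embed_vertex]
      exact exists_path_of_opponent_move hτ hG hR hq hn hE
  have hreach : ∀ n, (hGraph R G).CompatiblyReachable P τ (embed R u₀) (embed R (π n)) := by
    intro n
    induction n with
    | zero => exact hπ.1 ▸ .refl
    | succ n ih =>
      obtain ⟨v, hv, h⟩ := hpath n ih
      exact (ih.tail hv).trans (Relation.ReflTransGen.mono (fun _ _ h => h.2) _ _ h)
  obtain ⟨π', p, hp, h₀, hE, hπ', haux⟩ := exists_concat_paths fun n => hpath n (hreach n)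
  obtain ⟨d, hd⟩ := G.color_bounded
  refine (ParityGameGraph.wonBy_iff_of_color (H := hGraph R G) hp (fun n => ?_) (fun m => ?_)
    (fun n => hd _ (hV n)) P).1 (hτ.2 π' ⟨h₀.trans (congrArg _ hπ.1), fun n => (hE n).1⟩
      fun n => (hE n).2)
  · obtain ⟨w, q, hx⟩ := hG.mem_V_iff.1 (hV n)
    rw [hπ', hx, embed_vertex, hGraph_color_gState, hG.color_eq [] w]
  · refine (haux m).imp id ?_
    rintro ⟨w, P', s, hm⟩
    rw [hm, hGraph_color_auxState]
    exact P'.losingColor_le_one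

end MSOGame

/-! ### The proposition -/

theorem proposition3p14 {A QI QII : Type} [Finite A] [Finite QI] [Finite QII]
    (G : ParityGameGraph (List (A ⊕ (QI ⊕ QII))))
    (hrec : G.IsPrefixRecognizable) (hnormal : G.IsNormal)
    (R : RuleFamily (A ⊕ (QI ⊕ QII))) (hR : R.Represents G)
    (P : Player) (u₀ : List (A ⊕ (QI ⊕ QII))) (hu₀ : u₀ ∈ G.V)
    (τ : List (HAlphabet R) → List (HAlphabet R))
    (hτ : (hGraph R G).IsWinningStrategy P (embed R u₀) τ)
    (φ : MSO (HAlphabet R) 2 0)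
    (hφ : φ.DefinesStrategy (hGraph R G) P (embed R u₀) τ) :
    ∃ σ : List (A ⊕ (QI ⊕ QII)) → List (A ⊕ (QI ⊕ QII)),
      G.IsWinningStrategy P u₀ σ ∧
        ∃ χ : MSO (A ⊕ (QI ⊕ QII)) 2 0, χ.DefinesStrategy G P u₀ σ := by
  classical
  have hE : MSODef₂ G.E := by
    obtain ⟨d, φ₁, φ₂, ψ, δ, -, -, hψ, -⟩ := hrec
    exact ⟨ψ, fun x y => (hψ x y).symm⟩
  obtain ⟨D, hD, hDE⟩ := exists_definable_choice hE hnormal hR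
  let S : List (A ⊕ (QI ⊕ QII)) → List (A ⊕ (QI ⊕ QII)) → Prop := fun x y =>
    G.E x y ∧ MacroStep R P φ.Holds₂ (embed R x) (embed R y)
  -- Off the compatible plays `φ` may be arbitrary, so uniqueness of the successor is built into the
  -- formula.
  let U : List (A ⊕ (QI ⊕ QII)) → List (A ⊕ (QI ⊕ QII)) → Prop := fun x y =>
    S x y ∧ ∀ y', S x y' → y' = y
  have hU : ∀ {x y y'}, U x y → U x y' → y' = y := fun h h' => h.2 _ h'.1
  -- The simulated move where it is unambiguous, the default edge elsewhere; so `F` is the graph of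
  -- a function on all vertices of `G`.
  let F : List (A ⊕ (QI ⊕ QII)) → List (A ⊕ (QI ⊕ QII)) → Prop := fun x y =>
    U x y ∨ (¬ ∃ z, U x z) ∧ D x y
  have hF : ∀ x, ∃ y, x ∈ G.V → G.E x y ∧ ∀ y', F x y' ↔ y' = y := by
    intro x
    by_cases hx : x ∈ G.V
    · by_cases h : ∃ z, U x z
      · obtain ⟨z, hz⟩ := h
        refine ⟨z, fun _ => ⟨hz.1.1, fun y' => ⟨?_, ?_⟩⟩⟩
        · rintro (hy' | ⟨hne, -⟩)
          · exact hU hz hy'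
          · exact (hne ⟨z, hz⟩).elim
        · rintro rfl
          exact Or.inl hz
      · obtain ⟨y, hy, hiff⟩ := hDE x hx
        refine ⟨y, fun _ => ⟨hy, fun y' => ?_⟩⟩
        rw [← hiff y']
        exact ⟨fun h' => h'.elim (fun hy' => (h ⟨y', hy'⟩).elim) And.right,
          fun h' => Or.inr ⟨h, h'⟩⟩
    · exact ⟨[], fun h => (hx h).elim⟩
  choose σ hσ using hF
  refine ⟨σ, isWinningStrategy_of_macroStep hnormal hR hτ hφ (fun x hx => (hσ x hx).1) ?_, ?_⟩
  · intro x hx hreach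
    have hxV := ParityGameGraph.mem_V_of_mem_ownedBy hx
    obtain ⟨w, q, hq, rfl⟩ := hnormal.mem_ownedBy_iff.1 hx
    rw [embed_vertex] at hreach ⊢
    obtain ⟨w', q', hE', hround⟩ := exists_macroStep hτ hφ hnormal hR hq hreach
    have hUy : U (vertex w q) (vertex w' q') := by
      refine ⟨⟨hE', by rwa [embed_vertex, embed_vertex]⟩, fun y' hy' => ?_⟩
      obtain ⟨w₂, q₂, rfl⟩ := hnormal.mem_V_iff.1 (G.edge_mem _ _ hy'.1).2
      have h₂ := hy'.2
      rw [embed_vertex, embed_vertex] at h₂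
      exact vertex_inj.2 (MacroStep.unique hτ hφ hq hreach h₂ hround)
    rw [← ((hσ _ hxV).2 _).1 (Or.inl hUy), embed_vertex]
    exact hround
  -- The code for the control states of `H` needs a letter of `A` as end marker.
  · rcases isEmpty_or_nonempty A with hA | hA
    · exact exists_definesStrategy_of_isEmpty hnormal P u₀ σ
    · obtain ⟨M, hM, hMiff⟩ := (MSODef₂.macroStep (R := R) (T := φ.Holds₂)
        ⟨φ, fun _ _ => Iff.rfl⟩ P).comap_embed hnormal ⟨u₀, hu₀⟩
      have hS : MSODef₂ S := (MSODef.def₂ ((hE.at 0 1).and (hM.at 0 1))).congr fun x y =>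
        and_congr_right fun h => (hMiff x (G.edge_mem _ _ h).1 y (G.edge_mem _ _ h).2).symm
      have hUdef : MSODef₂ U := MSODef.def₂ ((hS.at 0 1).and (MSODef.allNode
        (R := fun ρ _ y' => S (ρ 0) y' → y' = ρ 1) ((hS.at 1 0).imp (MSODef.eq 0 2))))
      have hFdef : MSODef₂ F := MSODef.def₂ ((hUdef.at 0 1).or (MSODef.and (MSODef.not
        (MSODef.exNode (R := fun ρ _ z => U (ρ 0) z) (hUdef.at 1 0))) (hD.at 0 1)))
      obtain ⟨χ, hχ⟩ := hFdef
      exact ⟨χ, fun x hx _ y => (hχ x y).trans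
        ((hσ x (ParityGameGraph.mem_V_of_mem_ownedBy hx)).2 y)⟩
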